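/- Let $\mathrm{RandomSet}$ and the two-phase algorithm be defined as follows, for instances $(G,T,p)$ of Directed Vertex Multiway Cut: $G$ is a finite directed graph with a set $V^\infty(G)\subseteq V(G)$ of undeletable vertices, $T\subseteq V^\infty(G)$ is the set of terminals, and $p\ge 0$ is an integer. A solution is a set $S\subseteq V(G)\setminus V^\infty(G)$ with $|S|\le p$ such that $G\setminus S$ has no path between two distinct terminals; $(G,T,p)$ is a yes-instance if it has a solution. For disjoint non-empty $X,Y\subseteq V(G)$, an $X$-$Y$ separator is a set $S\subseteq V(G)\setminus(X\cup Y\cup V^\infty(G))$ such that $G\setminus S$ has no path from $X$ to $Y$. It is minimal if no proper subset of it is an $X$-$Y$ separator, and an important $X$-$Y$ separator if moreover there is no $X$-$Y$ separator $S'$ with $|S'|\le|S|$ such that the set of vertices reachable from $X$ in $G\setminus S'$ properly contains the set of vertices reachable from $X$ in $G\setminus S$. Let $\mathcal I_p$ be the collection of all sets of size at most $p$ that are important $\{v\}$-$T$ separators for some $v\in V(G)\setminus T$. The exact reverse shadow of $S$ is the set of vertices $v$ such that $S$ is a minimal $\{v\}$-$T$ separator. $\mathrm{RandomSet}(G,T,p)$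 is the random set obtained by selecting each member of the set $\mathcal X$ of exact reverse shadows of members of $\mathcal I_p$ independently with probability $1/2$ and taking the union of the selected sets. For $C\subseteq V(G)$, $\mathrm{torso}(G,C)$ is the directed graph with vertex set $C$ and an edge $(a,b)$ whenever $G$ has a path from $a$ to $b$ all of whose internal vertices lie outside $C$. Algorithm, on input $(G_1,T,p)$: 1. Draw $Z_1=\mathrm{RandomSet}(G_1,T,p)$. 2. Let $G_2$ be $G_1$ with all edges reversed and with $V^\infty(G_2)=V^\infty(G_1)\cup Z_1$. 3. Draw $Z_2=\mathrm{RandomSet}(G_2,T,p)$ (with fresh randomness), and let $Z=Z_1\cup Z_2$. 4. Let $G_3=\mathrm{torso}(G_1,V(G_1)\setminus Z)$, with undeletable vertices $V^\infty(G_1)\setminus Z$. 5. With an exact procedure for Undirected Vertex Multiway Cut, solve the instance $(G_3^*,T,p)$, where $G_3^*$ is the underlying undirected graph of $G_3$. Return the solution found, or "NO" if there is none. Lemma. There is a function $f:\mathbb N\to\mathbb N$ with $f(p)=O(p)$ such that, whichever exact procedure is used in step 5, for every yes-instance $I_1=(G_1,T,p)$ the algorithm returns a set $S$ that is a solution of $I_1$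 with probability at least $2^{-2^{f(p)}}$. -/

import Mathlib

open scoped ENNReal

universe u

noncomputable section

/-- A finite directed graph whose vertex set is a finite subset of an ambient type `V`. -/
structure FinDigraph (V : Type u) where
  verts : Finset V
  Adj : V → V → Prop
  mem_of_adj : ∀ {a b : V}, Adj a b → a ∈ verts ∧ b ∈ verts

namespace FinDigraph

variable {V : Type u}

/-- There is a directed path (possibly of length zero) from `a` to `b` in `G`. -/
def Reach (G : FinDigraph V) (a b : V) : Prop :=
  a ∈ G.verts ∧ Relation.ReflTransGen G.Adj a b

/-- The set `R⁺_G(X)` of vertices reachable from `X` in `G`. -/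
def reachSet (G : FinDigraph V) (X : Finset V) : Set V :=
  {b | ∃ a ∈ X, G.Reach a b}

/-- The graph `G_rev`: every edge is reversed. -/
def reverse (G : FinDigraph V) : FinDigraph V where
  verts := G.verts
  Adj a b := G.Adj b a
  mem_of_adj h := (G.mem_of_adj h).symm

/-- `torso(G, C)`: the vertex set is `C`, and `(a, b)` is an edge iff `G` has a path
`a → x₁ → ⋯ → xₘ → b` (`m ≥ 0`) all of whose internal vertices `x₁, …, xₘ` lie outside `C`. -/
def torso (G : FinDigraph V) (C : Finset V) : FinDigraph V where
  verts := C
  Adj a b := a ∈ C ∧ b ∈ C ∧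
    ∃ l : List V, (∀ x ∈ l, x ∉ C) ∧ List.IsChain G.Adj (a :: (l ++ [b]))
  mem_of_adj h := ⟨h.1, h.2.1⟩

variable [DecidableEq V]

/-- The graph `G ∖ S` obtained by deleting the vertices of `S`. -/
def delete (G : FinDigraph V) (S : Finset V) : FinDigraph V where
  verts := G.verts \ S
  Adj a b := G.Adj a b ∧ a ∉ S ∧ b ∉ S
  mem_of_adj h :=
    ⟨Finset.mem_sdiff.2 ⟨(G.mem_of_adj h.1).1, h.2.1⟩,
      Finset.mem_sdiff.2 ⟨(G.mem_of_adj h.1).2, h.2.2⟩⟩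

/-- `S` is an `X`–`Y` separator in `G`, where `D` is the set of distinguished (undeletable)
vertices: `X` and `Y` are disjoint and non-empty, `S ⊆ V(G) ∖ (X ∪ Y ∪ D)`, and `G ∖ S` has no
path from `X` to `Y`. -/
def IsSeparator (G : FinDigraph V) (D X Y S : Finset V) : Prop :=
  X.Nonempty ∧ Y.Nonempty ∧ Disjoint X Y ∧ S ⊆ G.verts \ (X ∪ Y ∪ D) ∧
    ∀ x ∈ X, ∀ y ∈ Y, ¬ (G.delete S).Reach x y

/-- An inclusion-wise minimal `X`–`Y` separator. -/
def IsMinimalSeparator (G : FinDigraph V) (D X Y S : Finset V) : Prop :=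
  Minimal (G.IsSeparator D X Y) S

/-- An important `X`–`Y` separator: a minimal one such that no `X`–`Y` separator of at most the
same size has a strictly larger set of vertices reachable from `X`. -/
def IsImportantSeparator (G : FinDigraph V) (D X Y S : Finset V) : Prop :=
  G.IsMinimalSeparator D X Y S ∧
    ¬ ∃ S' : Finset V, G.IsSeparator D X Y S' ∧ S'.card ≤ S.card ∧
      (G.delete S).reachSet X ⊂ (G.delete S').reachSet X

end FinDigraph

/-- The data `(G, T, p)` of an instance of Directed (Vertex) Multiway Cut, together with the set
`V^∞(G)` of distinguished (undeletable) vertices. -/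
structure DirectedInstance (V : Type u) where
  graph : FinDigraph V
  distinguished : Finset V
  terminals : Finset V
  budget : ℕ

/-- The data of an instance of Undirected (Vertex) Multiway Cut with distinguished vertices. -/
structure UndirectedInstance (V : Type u) where
  verts : Finset V
  graph : SimpleGraph V
  distinguished : Finset V
  terminals : Finset V
  budget : ℕ

namespace UndirectedInstance

variable {V : Type u}

/-- The data form an instance: edges join vertices of the graph, and `T ⊆ V^∞ ⊆ V(G)`. -/
def WellFormed (J : UndirectedInstance V) : Prop :=
  (∀ a b, J.graph.Adj a b → a ∈ J.verts) ∧
    J.terminals ⊆ J.distinguished ∧ J.distinguished ⊆ J.verts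

/-- `S` consists of at most `p` non-distinguished vertices, and no two distinct terminals are
joined by a path that avoids `S`. -/
def IsSolution [DecidableEq V] (J : UndirectedInstance V) (S : Finset V) : Prop :=
  S ⊆ J.verts \ J.distinguished ∧ S.card ≤ J.budget ∧
    ∀ s ∈ J.terminals, ∀ t ∈ J.terminals, s ≠ t →
      ¬ ∃ w : J.graph.Walk s t, ∀ x ∈ w.support, x ∉ S

/-- An exact procedure for Undirected Multiway Cut: on every instance it returns a solution if
there is one, and `none` (that is, "NO") otherwise. -/
def IsExactSolver [DecidableEq V] (solve : UndirectedInstance V → Option (Finset V)) : Prop :=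
  ∀ J : UndirectedInstance V, J.WellFormed →
    (∀ S, solve J = some S → J.IsSolution S) ∧ (solve J = none → ∀ S, ¬ J.IsSolution S)

/-- Exact procedures exist (exhaustive search is one). -/
theorem exists_isExactSolver [DecidableEq V] :
    ∃ solve : UndirectedInstance V → Option (Finset V), IsExactSolver solve := by
  classical
  refine ⟨fun J => if h : ∃ S, J.IsSolution S then some h.choose else none, fun J _ => ?_⟩
  by_cases h : ∃ S, J.IsSolution S
  · simpa [h] using h.choose_spec
  · exact ⟨fun S hS => by simp [h] at hS, fun _ S hS => h ⟨S, hS⟩⟩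

end UndirectedInstance

namespace DirectedInstance

variable {V : Type u}

/-- The data form an instance: `T ⊆ V^∞(G) ⊆ V(G)`. -/
def WellFormed (I : DirectedInstance V) : Prop :=
  I.terminals ⊆ I.distinguished ∧ I.distinguished ⊆ I.graph.verts

variable [DecidableEq V]

/-- `S` is a solution: a multiway cut of `(G, T)` that consists of at most `p` non-distinguished
vertices, so `G ∖ S` has no path between two distinct terminals. -/
def IsSolution (I : DirectedInstance V) (S : Finset V) : Prop :=
  S ⊆ I.graph.verts \ I.distinguished ∧ S.card ≤ I.budget ∧
    ∀ s ∈ I.terminals, ∀ t ∈ I.terminals, s ≠ t → ¬ (I.graph.delete S).Reach s t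

/-- A yes-instance is one that has a solution. -/
def IsYes (I : DirectedInstance V) : Prop := ∃ S, I.IsSolution S

open scoped Classical in
/-- The collection `𝓘_p`: all important `v`–`T` separators of size at most `p`, over all
`v ∈ V(G) ∖ T`. -/
def importantSeparators (I : DirectedInstance V) : Finset (Finset V) :=
  I.graph.verts.powerset.filter fun S => S.card ≤ I.budget ∧
    ∃ v ∈ I.graph.verts \ I.terminals,
      I.graph.IsImportantSeparator I.distinguished {v} I.terminals S

open scoped Classical in
/-- The exact reverse shadow of `S`: the vertices `v` such that `S` is a minimal `v`–`T`
separator. -/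
def exactReverseShadow (I : DirectedInstance V) (S : Finset V) : Finset V :=
  I.graph.verts.filter fun v =>
    I.graph.IsMinimalSeparator I.distinguished {v} I.terminals S

/-- The set `𝒳` of the exact reverse shadows of the members of `𝓘_p`. -/
def exactShadows (I : DirectedInstance V) : Finset (Finset V) :=
  I.importantSeparators.image I.exactReverseShadow

/-- The random set `RandomSet(G, T, p)`: select every member of `𝒳` independently with probability
`1/2` (equivalently, draw a subset `𝒳'` of `𝒳` uniformly at random) and return the union of the
selected sets. -/
def randomSet (I : DirectedInstance V) : PMF (Finset V) :=
  (PMF.uniformOfFinset I.exactShadows.powerset (Finset.powerset_nonempty _)).map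
    fun X' => X'.sup id

/-- The instance of the second sampling phase: all edges are reversed and the vertices of `Z₁`
become distinguished. -/
def reverseWith (I : DirectedInstance V) (Z₁ : Finset V) : DirectedInstance V where
  graph := I.graph.reverse
  distinguished := I.distinguished ∪ Z₁
  terminals := I.terminals
  budget := I.budget

/-- The instance on the graph `torso(G, V(G) ∖ Z)` with the same terminals and budget; the
distinguished vertices are those of `G` that are left. -/
def reduce (I : DirectedInstance V) (Z : Finset V) : DirectedInstance V where
  graph := I.graph.torso (I.graph.verts \ Z)
  distinguished := I.distinguished \ Z
  terminals := I.terminals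
  budget := I.budget

/-- The underlying undirected instance `(G*, T, p)`: orientations are disregarded. -/
def underlying (I : DirectedInstance V) : UndirectedInstance V where
  verts := I.graph.verts
  graph := SimpleGraph.fromRel I.graph.Adj
  distinguished := I.distinguished
  terminals := I.terminals
  budget := I.budget

/-- The two-phase sampling algorithm, as the distribution of its output (`none` means "NO"):
sample `Z₁ = RandomSet(G₁, T, p)`; reverse all edges and make `Z₁` undeletable; sample
`Z₂ = RandomSet(G₂, T, p)`; take the torso that removes `Z = Z₁ ∪ Z₂`; solve the underlying
undirected instance by the procedure `solve` and return its answer. -/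
def multiwayCutAlgorithm (solve : UndirectedInstance V → Option (Finset V))
    (I : DirectedInstance V) : PMF (Option (Finset V)) :=
  I.randomSet.bind fun Z₁ =>
    (I.reverseWith Z₁).randomSet.map fun Z₂ =>
      solve (I.reduce (Z₁ ∪ Z₂)).underlying

end DirectedInstance

end

open scoped ENNReal

/-! Fix a solution S that minimizes, lexicographically, its size, the number of live vertices (those
that reach a terminal and are reached from one in G∖S), and the number of vertices that reach a
terminal in G∖S. If S separates v from T without containing an important v–T separator, part of S
can be pushed towards T (`IsSolution.exists_push`), against the third minimality. So the exact
reverse shadows of the important separators inside S cover everything that S cuts off from T.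

A run of RandomSet succeeds if it selects these at most 2^p shadows and rejects every shadow that
meets S. A shadow that contains x ∈ S comes from a separator that is important for x itself
(`IsImportantSeparator.of_isMinimalSeparator`), and x has at most 4^p of those
(`card_importantSeparators_le`), so at most p·4^p shadows are rejected. No vertex of S is redundant,
so the two families are disjoint and the probability is at least 2^(-2^(3p)).

In the second phase Z₁ is undeletable, so a push in the reversed graph would have to delete a live
vertex, against the second minimality. If both phases succeed, every remaining vertex outside S is
live, and it reaches and is reached from one single terminal. Hence the torso minus S links no two
terminals even when orientations are ignored. Conversely, every solution of the torso instance
solves the original one, so the solver's choice does not matter. -/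

noncomputable section

/-! ### Connected regions with small boundary and the 4^k bound -/

namespace FinDigraph

variable {V : Type u} {G : FinDigraph V}

open scoped Classical in
/-- The out-neighbourhood `N⁺(A)` of a vertex set `A` (which excludes `A`). -/
def outBoundary (G : FinDigraph V) (A : Finset V) : Finset V :=
  G.verts.filter fun b => b ∉ A ∧ ∃ a ∈ A, G.Adj a b

theorem mem_outBoundary {A : Finset V} {b : V} :
    b ∈ G.outBoundary A ↔ b ∉ A ∧ ∃ a ∈ A, G.Adj a b := by
  simp only [outBoundary, Finset.mem_filter, and_iff_right_iff_imp]
  rintro ⟨-, a, -, h⟩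
  exact (G.mem_of_adj h).2

/-- Every vertex of `A` can be reached from `v ∈ A` by a path inside `A`. -/
def ConnFrom (G : FinDigraph V) (v : V) (A : Finset V) : Prop :=
  v ∈ A ∧ ∀ a ∈ A, Relation.ReflTransGen (fun x y => G.Adj x y ∧ x ∈ A ∧ y ∈ A) v a

theorem ConnFrom.subset_of_closed {v : V} {A M : Finset V} (hA : G.ConnFrom v A) (hv : v ∈ M)
    (hM : Disjoint A (G.outBoundary M)) : A ⊆ M := by
  intro a ha
  induction hA.2 a ha with
  | refl => exact hv
  | tail _ h ih =>
    by_contra hc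
    exact Finset.disjoint_left.1 hM h.2.2 (mem_outBoundary.2 ⟨hc, _, ih h.2.1, h.1⟩)

open scoped Classical in
/-- The part of `A` that can be reached from `v` inside `A`. -/
def core (G : FinDigraph V) (v : V) (A : Finset V) : Finset V :=
  A.filter fun a => Relation.ReflTransGen (fun x y => G.Adj x y ∧ x ∈ A ∧ y ∈ A) v a

theorem mem_core {v a : V} {A : Finset V} : a ∈ G.core v A ↔
    a ∈ A ∧ Relation.ReflTransGen (fun x y => G.Adj x y ∧ x ∈ A ∧ y ∈ A) v a := by
  simp only [core, Finset.mem_filter]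

theorem core_subset (v : V) (A : Finset V) : G.core v A ⊆ A := fun _ h => (mem_core.1 h).1

theorem connFrom_core {v : V} {A : Finset V} (hv : v ∈ A) : G.ConnFrom v (G.core v A) := by
  refine ⟨mem_core.2 ⟨hv, .refl⟩, fun a ha => ?_⟩
  have h := (mem_core.1 ha).2
  clear ha
  induction h with
  | refl => exact .refl
  | tail h₁ h₂ ih =>
    exact ih.tail ⟨h₂.1, mem_core.2 ⟨h₂.2.1, h₁⟩,
      mem_core.2 ⟨h₂.2.2, h₁.tail h₂⟩⟩

/-- An out-neighbour of the core that lies in A belongs to the core. Passing to the core therefore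
never costs boundary, and minimizers may be taken connected. -/
theorem outBoundary_core_subset (v : V) (A : Finset V) :
    G.outBoundary (G.core v A) ⊆ G.outBoundary A := by
  intro b hb
  obtain ⟨hb, a, ha, hab⟩ := mem_outBoundary.1 hb
  obtain ⟨haA, ha⟩ := mem_core.1 ha
  refine mem_outBoundary.2 ⟨fun hbA => hb (mem_core.2 ⟨hbA, ha.tail ⟨hab, haA, hbA⟩⟩),
    a, haA, hab⟩

theorem ConnFrom.subset_core {v : V} {Y A : Finset V} (hY : G.ConnFrom v Y) (h : Y ⊆ A) :
    Y ⊆ G.core v A := fun y hy =>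
  mem_core.2 ⟨h hy, (hY.2 y hy).lift id fun _ _ h' => ⟨h'.1, h h'.2.1, h h'.2.2⟩⟩

/-- Vertex sets that contain `Y`, avoid `F`, and have no out-neighbour in `W`. -/
def IsRegion (G : FinDigraph V) (W F Y A : Finset V) : Prop :=
  A ⊆ G.verts ∧ Y ⊆ A ∧ Disjoint A F ∧ Disjoint (G.outBoundary A) W

theorem IsRegion.core {W F Y A : Finset V} {v : V} (hA : G.IsRegion W F Y A)
    (hY : G.ConnFrom v Y) : G.IsRegion W F Y (G.core v A) :=
  ⟨(core_subset v A).trans hA.1, hY.subset_core hA.2.1, hA.2.2.1.mono_left (core_subset v A),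
    hA.2.2.2.mono_left (outBoundary_core_subset v A)⟩

theorem outBoundary_subset_verts (A : Finset V) : G.outBoundary A ⊆ G.verts := fun _ h =>
  (G.mem_of_adj (mem_outBoundary.1 h).2.choose_spec.2).2

variable [DecidableEq V]

theorem outBoundary_union_subset (A B : Finset V) :
    G.outBoundary (A ∪ B) ⊆ G.outBoundary A ∪ G.outBoundary B := by
  intro b
  simp only [Finset.mem_union, mem_outBoundary]
  grind

theorem outBoundary_inter_subset (A B : Finset V) :
    G.outBoundary (A ∩ B) ⊆ G.outBoundary A ∪ G.outBoundary B := by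
  intro b
  simp only [Finset.mem_union, mem_outBoundary, Finset.mem_inter]
  grind

/-- After inclusion–exclusion on both sides, the union of the two sets on the left lies in the union
on the right, and likewise for the intersections. -/
theorem card_outBoundary_submodular (A B F : Finset V) :
    (G.outBoundary (A ∪ B) \ F).card + (G.outBoundary (A ∩ B) \ F).card ≤
      (G.outBoundary A \ F).card + (G.outBoundary B \ F).card := by
  rw [← Finset.card_union_add_card_inter, ← Finset.card_union_add_card_inter (G.outBoundary A \ F)]
  refine add_le_add (Finset.card_le_card ?_) (Finset.card_le_card ?_)
  all_goals
    intro b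
    simp only [Finset.mem_union, Finset.mem_inter, Finset.mem_sdiff, mem_outBoundary]
    grind

theorem ConnFrom.union {v : V} {A B : Finset V} (hA : G.ConnFrom v A) (hB : G.ConnFrom v B) :
    G.ConnFrom v (A ∪ B) := by
  refine ⟨Finset.mem_union_left _ hA.1, fun a ha => ?_⟩
  rcases Finset.mem_union.1 ha with h | h
  · exact (hA.2 a h).lift id fun x y hxy => ⟨hxy.1, by simp [hxy.2.1], by simp [hxy.2.2]⟩
  · exact (hB.2 a h).lift id fun x y hxy => ⟨hxy.1, by simp [hxy.2.1], by simp [hxy.2.2]⟩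

theorem ConnFrom.insert {v x : V} {A : Finset V} (hA : G.ConnFrom v A)
    (hx : x ∈ G.outBoundary A) : G.ConnFrom v (insert x A) := by
  have key : ∀ a ∈ A, Relation.ReflTransGen
      (fun y z => G.Adj y z ∧ y ∈ Insert.insert x A ∧ z ∈ Insert.insert x A) v a := fun a ha =>
    (hA.2 a ha).lift id fun y z h => ⟨h.1, by simp [h.2.1], by simp [h.2.2]⟩
  refine ⟨by simp [hA.1], fun a ha => ?_⟩
  rcases Finset.mem_insert.1 ha with rfl | h
  · obtain ⟨-, b, hb, hba⟩ := mem_outBoundary.1 hx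
    exact (key b hb).tail ⟨hba, by simp [hb], by simp⟩
  · exact key a h

theorem IsRegion.union {W F Y A B : Finset V} (hA : G.IsRegion W F Y A)
    (hB : G.IsRegion W F Y B) : G.IsRegion W F Y (A ∪ B) :=
  ⟨Finset.union_subset hA.1 hB.1, hA.2.1.trans Finset.subset_union_left,
    Finset.disjoint_union_left.2 ⟨hA.2.2.1, hB.2.2.1⟩,
    (Finset.disjoint_union_left.2 ⟨hA.2.2.2, hB.2.2.2⟩).mono_left (outBoundary_union_subset A B)⟩

theorem IsRegion.inter {W F Y A B : Finset V} (hA : G.IsRegion W F Y A)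
    (hB : G.IsRegion W F Y B) : G.IsRegion W F Y (A ∩ B) :=
  ⟨Finset.inter_subset_left.trans hA.1, Finset.subset_inter hA.2.1 hB.2.1,
    hA.2.2.1.mono_left Finset.inter_subset_left,
    (Finset.disjoint_union_left.2 ⟨hA.2.2.2, hB.2.2.2⟩).mono_left (outBoundary_inter_subset A B)⟩

/-- A region that can be reached from `v` inside itself, every larger such region having a larger
boundary outside `F`. -/
def IsImportantRegion (G : FinDigraph V) (W : Finset V) (v : V) (F Y A : Finset V) : Prop :=
  G.IsRegion W F Y A ∧ G.ConnFrom v A ∧ ∀ B, G.IsRegion W F Y B → G.ConnFrom v B → A ⊂ B →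
    (G.outBoundary A \ F).card < (G.outBoundary B \ F).card

open scoped Classical in
/-- The important regions whose boundary outside `F` has at most `k` vertices. -/
def importantRegions (G : FinDigraph V) (W : Finset V) (v : V) (F Y : Finset V) (k : ℕ) :
    Finset (Finset V) :=
  G.verts.powerset.filter fun A =>
    G.IsImportantRegion W v F Y A ∧ (G.outBoundary A \ F).card ≤ k

theorem mem_importantRegions {W F Y A : Finset V} {v : V} {k : ℕ} :
    A ∈ G.importantRegions W v F Y k ↔
      G.IsImportantRegion W v F Y A ∧ (G.outBoundary A \ F).card ≤ k := by
  simp only [importantRegions, Finset.mem_filter, Finset.mem_powerset, and_iff_right_iff_imp]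
  exact fun h => h.1.1.1

/-- There is a largest connected region among those with the smallest boundary. -/
theorem exists_maximal_minimizer {W F Y A₀ : Finset V} {v : V} (hY : G.ConnFrom v Y)
    (hA₀ : G.IsRegion W F Y A₀) :
    ∃ M, G.IsRegion W F Y M ∧ G.ConnFrom v M ∧
      (∀ B, G.IsRegion W F Y B → (G.outBoundary M \ F).card ≤ (G.outBoundary B \ F).card) ∧
      ∀ B, G.IsRegion W F Y B → M ⊂ B → G.ConnFrom v B →
        (G.outBoundary M \ F).card < (G.outBoundary B \ F).card := by
  classical
  obtain ⟨M₀, hM₀, hmin⟩ := Finset.exists_min_image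
    (G.verts.powerset.filter (G.IsRegion W F Y)) (fun A => (G.outBoundary A \ F).card)
    ⟨A₀, by simpa using ⟨hA₀.1, hA₀⟩⟩
  have hM₀' : G.IsRegion W F Y M₀ := (Finset.mem_filter.1 hM₀).2
  have hle : ∀ B, G.IsRegion W F Y B →
      (G.outBoundary M₀ \ F).card ≤ (G.outBoundary B \ F).card := fun B hB =>
    hmin B (by simpa using ⟨hB.1, hB⟩)
  obtain ⟨M, hM, hmax⟩ := Finset.exists_max_image
    (G.verts.powerset.filter fun A => G.IsRegion W F Y A ∧ G.ConnFrom v A ∧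
      (G.outBoundary A \ F).card ≤ (G.outBoundary M₀ \ F).card) Finset.card
    ⟨G.core v M₀, by
      simp only [Finset.mem_filter, Finset.mem_powerset]
      exact ⟨(hM₀'.core hY).1, hM₀'.core hY, connFrom_core (hM₀'.2.1 hY.1),
        Finset.card_le_card (Finset.sdiff_subset_sdiff (outBoundary_core_subset v M₀) le_rfl)⟩⟩
  simp only [Finset.mem_filter, Finset.mem_powerset] at hM hmax
  obtain ⟨-, hMr, hMc, hMle⟩ := hM
  refine ⟨M, hMr, hMc, fun B hB => hMle.trans (hle B hB), fun B hB hMB hBc => ?_⟩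
  by_contra! hlt
  exact absurd (hmax B ⟨hB.1, hB, hBc, hlt.trans hMle⟩) (Finset.card_lt_card hMB).not_ge

/-- Branching with measure 2k − l, where l bounds all boundaries from below. Every important region
contains the largest connected minimizer M. For a vertex x of its boundary outside F, either x joins
the region, which raises l, or x is forced into the boundary by adding it to F, which lowers k and l
by one each. Both branches lower the measure. -/
theorem card_importantRegions_le_of_lower_bound {W : Finset V} {v : V} (n : ℕ) :
    ∀ (F Y : Finset V) (k l : ℕ), G.ConnFrom v Y →
      (∀ B, G.IsRegion W F Y B → l ≤ (G.outBoundary B \ F).card) → 2 * k ≤ l + n →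
      (G.importantRegions W v F Y k).card ≤ 2 ^ n := by
  induction n with
  | zero => ?_
  | succ n ih => ?_
  all_goals
    intro F Y k l hY hl hk
    rcases (G.importantRegions W v F Y k).eq_empty_or_nonempty with he | ⟨A₀, hA₀⟩
    · simp [he]
    rw [mem_importantRegions] at hA₀
    obtain ⟨M, hMr, hMc, hMmin, hMmax⟩ := exists_maximal_minimizer hY hA₀.1.1
    have hMk := (hMmin A₀ hA₀.1.1).trans hA₀.2
    have hlM := hl M hMr
    -- Otherwise A ∪ M has a larger boundary than A, while A ∩ M has at least that of M, against
    -- submodularity.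
    have hsub : ∀ A, G.IsImportantRegion W v F Y A → M ⊆ A := by
      intro A hA
      by_contra hMA
      have h₁ := hA.2.2 (A ∪ M) (hA.1.union hMr) (hA.2.1.union hMc)
        (Finset.ssubset_iff_subset_ne.2 ⟨Finset.subset_union_left, fun h =>
          hMA (h ▸ Finset.subset_union_right)⟩)
      have h₂ := hMmin _ (hA.1.inter hMr)
      have h₃ := G.card_outBoundary_submodular A M F
      omega
    have hzero : (G.outBoundary M \ F).card = 0 → (G.importantRegions W v F Y k).card ≤ 1 := by
      intro h0
      refine Finset.card_le_one_iff_subset_singleton.2 ⟨M, fun A hA => ?_⟩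
      have hA := (mem_importantRegions.1 hA).1
      refine Finset.mem_singleton.2 (Finset.Subset.antisymm ?_ (hsub A hA))
      exact hA.2.1.subset_of_closed hMc.1
        (hA.1.2.2.1.mono_right (Finset.sdiff_eq_empty_iff_subset.1 (Finset.card_eq_zero.1 h0)))
  -- Here 2k ≤ l ≤ |∂M∖F| ≤ k, so the boundary outside F is empty.
  · exact hzero (by omega)
  · rcases Nat.eq_zero_or_pos (G.outBoundary M \ F).card with h0 | hpos
    · exact (hzero h0).trans Nat.one_le_two_pow
    obtain ⟨x, hx⟩ := Finset.card_pos.1 hpos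
    obtain ⟨hxM, hxF⟩ := Finset.mem_sdiff.1 hx
    have hboundary : ∀ B, M ⊆ B → x ∉ B →
        (G.outBoundary B \ F).card = (G.outBoundary B \ insert x F).card + 1 := by
      intro B hMB hxB
      have hxB' : x ∈ G.outBoundary B \ F := by
        obtain ⟨-, a, ha, hax⟩ := mem_outBoundary.1 hxM
        exact Finset.mem_sdiff.2 ⟨mem_outBoundary.2 ⟨hxB, a, hMB ha, hax⟩, hxF⟩
      rw [Finset.sdiff_insert, Finset.card_erase_add_one hxB']
    have hinsert : ∀ B, G.IsRegion W F (insert x M) B → G.IsRegion W F Y B := fun B hB =>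
      ⟨hB.1, hMr.2.1.trans ((Finset.subset_insert x M).trans hB.2.1), hB.2.2⟩
    have hforce : ∀ B, G.IsRegion W (insert x F) M B →
        G.IsRegion W F Y B ∧ M ⊆ B ∧ x ∉ B := fun B hB =>
      ⟨⟨hB.1, hMr.2.1.trans hB.2.1, hB.2.2.1.mono_right (Finset.subset_insert x F), hB.2.2.2⟩,
        hB.2.1, fun h => Finset.disjoint_left.1 hB.2.2.1 h (Finset.mem_insert_self x F)⟩
    have hcov : G.importantRegions W v F Y k ⊆
        G.importantRegions W v F (insert x M) k ∪
          G.importantRegions W v (insert x F) M (k - 1) := by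
      intro A hA
      obtain ⟨hA, hAk⟩ := mem_importantRegions.1 hA
      have hMA := hsub A hA
      rw [Finset.mem_union, mem_importantRegions, mem_importantRegions]
      by_cases hxA : x ∈ A
      · exact Or.inl ⟨⟨⟨hA.1.1, Finset.insert_subset hxA hMA, hA.1.2.2⟩, hA.2.1,
          fun B hB => hA.2.2 B (hinsert B hB)⟩, hAk⟩
      · have h1 := hboundary A hMA hxA
        refine Or.inr ⟨⟨⟨hA.1.1, hMA, Finset.disjoint_insert_right.2 ⟨hxA, hA.1.2.2.1⟩,
          hA.1.2.2.2⟩, hA.2.1, fun B hB hBc hAB => ?_⟩, by omega⟩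
        obtain ⟨hB', hMB, hxB⟩ := hforce B hB
        have h2 := hboundary B hMB hxB
        have h3 := hA.2.2 B hB' hBc hAB
        omega
    refine (Finset.card_le_card hcov).trans ((Finset.card_union_le _ _).trans ?_)
    rw [pow_succ, mul_two]
    refine add_le_add (ih F (insert x M) k ((G.outBoundary M \ F).card + 1) (hMc.insert hxM) ?_ ?_)
      (ih (insert x F) M (k - 1) ((G.outBoundary M \ F).card - 1) hMc ?_ ?_)
    -- The core of B strictly contains M, so maximality of M makes its boundary exceed that of M by
    -- at least one.
    · intro B hB
      have hC := (hinsert B hB).core hY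
      have hMB : insert x M ⊆ G.core v B := (hMc.insert hxM).subset_core hB.2.1
      refine (hMmax _ hC ((Finset.ssubset_insert (mem_outBoundary.1 hxM).1).trans_subset hMB)
        (connFrom_core ((hinsert B hB).2.1 hY.1))).trans_le ?_
      exact Finset.card_le_card (Finset.sdiff_subset_sdiff (outBoundary_core_subset v B) le_rfl)
    · omega
    · intro B hB
      obtain ⟨hB', hMB, hxB⟩ := hforce B hB
      have h2 := hboundary B hMB hxB
      have h3 := hMmin B hB'
      omega
    · omega

theorem card_importantRegions_le (W F : Finset V) (v : V) (k : ℕ) :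
    (G.importantRegions W v F {v} k).card ≤ 4 ^ k := by
  have h : G.ConnFrom v {v} := ⟨by simp, fun a ha => by rw [Finset.mem_singleton.1 ha]⟩
  -- The trivial lower bound l = 0 gives measure 2k, and 2^(2k) = 4^k.
  refine (card_importantRegions_le_of_lower_bound (2 * k) F {v} k 0 h
    (fun _ _ => Nat.zero_le _) (by omega)).trans_eq ?_
  rw [pow_mul]; norm_num

end FinDigraph

/-! ### Reachability after deletion, minimal and important separators -/

namespace FinDigraph

section Reach

variable {V : Type u} {G : FinDigraph V} {a b c : V}

theorem Reach.trans (h₁ : G.Reach a b) (h₂ : G.Reach b c) : G.Reach a c :=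
  ⟨h₁.1, h₁.2.trans h₂.2⟩

theorem Reach.refl (h : a ∈ G.verts) : G.Reach a a := ⟨h, .refl⟩

theorem Reach.mem_right (h : G.Reach a b) : b ∈ G.verts := by
  cases h.2 with
  | refl => exact h.1
  | tail _ h => exact (G.mem_of_adj h).2

theorem Reach.tail (h₁ : G.Reach a b) (h₂ : G.Adj b c) : G.Reach a c :=
  ⟨h₁.1, h₁.2.tail h₂⟩

theorem Reach.head (h₁ : G.Adj a b) (h₂ : G.Reach b c) : G.Reach a c :=
  ⟨(G.mem_of_adj h₁).1, h₂.2.head h₁⟩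

theorem reach_reverse : G.reverse.Reach a b ↔ G.Reach b a := by
  have key : ∀ {H : FinDigraph V} {a b : V}, H.Reach a b → H.reverse.Reach b a := fun h =>
    ⟨h.mem_right, h.2.swap⟩
  exact ⟨fun h => key h, fun h => key h⟩

end Reach

variable {V : Type u} [DecidableEq V] {G : FinDigraph V} {D T S S' : Finset V} {a b u v x : V}

theorem Reach.notMem_left (h : (G.delete S).Reach a b) : a ∉ S := (Finset.mem_sdiff.1 h.1).2

theorem Reach.notMem_right (h : (G.delete S).Reach a b) : b ∉ S :=
  (Finset.mem_sdiff.1 h.mem_right).2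

theorem Reach.mono (h : (G.delete S).Reach a b) (hS : S' ⊆ S) : (G.delete S').Reach a b :=
  ⟨Finset.sdiff_subset_sdiff le_rfl hS h.1,
    h.2.lift id fun _ _ h => ⟨h.1, fun h' => h.2.1 (hS h'), fun h' => h.2.2 (hS h')⟩⟩

theorem reach_delete_reverse :
    (G.reverse.delete S).Reach a b ↔ (G.delete S).Reach b a := by
  have h : G.reverse.delete S = (G.delete S).reverse := by
    simp only [delete, reverse, mk.injEq, true_and]
    funext a b
    exact propext ⟨fun h => ⟨h.1, h.2.2, h.2.1⟩, fun h => ⟨h.1, h.2.2, h.2.1⟩⟩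
  rw [h, reach_reverse]

/-- A path either avoids `S` or meets it. -/
theorem Reach.avoids_or_meets (h : (G.delete S').Reach a b) (S : Finset V) :
    (G.delete S).Reach a b ∨ ∃ x ∈ S, (G.delete S').Reach a x ∧ (G.delete S').Reach x b := by
  obtain ⟨ha, h⟩ := h
  induction h with
  | refl =>
    by_cases haS : a ∈ S
    · exact .inr ⟨a, haS, .refl ha, .refl ha⟩
    · exact .inl (.refl (Finset.mem_sdiff.2 ⟨(Finset.mem_sdiff.1 ha).1, haS⟩))
  | @tail b c hab hbc ih =>
    have hac : (G.delete S').Reach a c := ⟨ha, hab.tail hbc⟩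
    rcases ih with ih | ⟨x, hx, h₁, h₂⟩
    · by_cases hc : c ∈ S
      · exact .inr ⟨c, hc, hac, .refl hac.mem_right⟩
      · exact .inl (ih.tail ⟨hbc.1, ih.notMem_right, hc⟩)
    · exact .inr ⟨x, hx, h₁, h₂.tail hbc⟩

/-- A path that avoids `S \ {x}` either avoids `S` or has a part before its first visit to `x`. -/
theorem Reach.avoids_or_reaches (h : (G.delete (S.erase x)).Reach a b) (ha : a ∉ S) :
    (G.delete S).Reach a b ∨ ∃ y, (G.delete S).Reach a y ∧ G.Adj y x := by
  obtain ⟨ha', h⟩ := h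
  induction h with
  | refl => exact .inl (.refl (Finset.mem_sdiff.2 ⟨(Finset.mem_sdiff.1 ha').1, ha⟩))
  | @tail b c hab hbc ih =>
    rcases ih with ih | ih
    · by_cases hc : c ∈ S
      · have hcx : c = x := by
          by_contra hne
          exact hbc.2.2 (Finset.mem_erase.2 ⟨hne, hc⟩)
        exact .inr ⟨b, ih, hcx ▸ hbc.1⟩
      · exact .inl (ih.tail ⟨hbc.1, ih.notMem_right, hc⟩)
    · exact .inr ih

/-- A path that avoids `S \ {x}` either avoids `S` or has a part after its last visit to `x`. -/
theorem Reach.avoids_or_leaves (h : (G.delete (S.erase x)).Reach a b) (hb : b ∉ S) :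
    (G.delete S).Reach a b ∨ ∃ y, G.Adj x y ∧ (G.delete S).Reach y b := by
  rcases (reach_delete_reverse.2 h).avoids_or_reaches hb with h | ⟨y, h₁, h₂⟩
  · exact .inl (reach_delete_reverse.1 h)
  · exact .inr ⟨y, h₂, reach_delete_reverse.1 h₁⟩

/-- Some terminal can be reached from `v` in `G ∖ S`. -/
def ReachesTerminal (G : FinDigraph V) (T S : Finset V) (v : V) : Prop :=
  ∃ t ∈ T, (G.delete S).Reach v t

theorem ReachesTerminal.notMem (h : G.ReachesTerminal T S v) : v ∉ S :=
  h.choose_spec.2.notMem_left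

/-- In `G ∖ S`, the vertex `v` can be reached from a terminal and reaches a terminal. -/
def IsLive (G : FinDigraph V) (T S : Finset V) (v : V) : Prop :=
  G.ReachesTerminal T S v ∧ G.reverse.ReachesTerminal T S v

theorem isLive_reverse : G.reverse.IsLive T S v ↔ G.IsLive T S v := and_comm

theorem isSeparator_singleton :
    G.IsSeparator D {v} T S ↔
      T.Nonempty ∧ v ∉ T ∧ v ∉ S ∧ S ⊆ G.verts \ (T ∪ D) ∧ ¬ G.ReachesTerminal T S v := by
  constructor
  · rintro ⟨-, hT, hvT, hS, h⟩
    refine ⟨hT, Finset.disjoint_singleton_left.1 hvT, fun hv => ?_, fun x hx => ?_, ?_⟩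
    · have := hS hv
      simp at this
    · have := hS hx
      simp only [Finset.mem_sdiff, Finset.mem_union] at this ⊢
      tauto
    · rintro ⟨t, ht, h'⟩
      exact h v (Finset.mem_singleton_self v) t ht h'
  · rintro ⟨hT, hvT, hvS, hS, h⟩
    refine ⟨Finset.singleton_nonempty v, hT, Finset.disjoint_singleton_left.2 hvT,
      fun x hx => ?_, fun w hw t ht h' => ?_⟩
    · have := hS hx
      have hne : x ≠ v := fun h => hvS (h ▸ hx)
      simp only [Finset.mem_sdiff, Finset.mem_union, Finset.mem_singleton] at this ⊢
      tauto
    · rw [Finset.mem_singleton.1 hw] at h'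
      exact h ⟨t, ht, h'⟩

theorem mem_reachSet_delete :
    b ∈ (G.delete S).reachSet {v} ↔ (G.delete S).Reach v b := by
  simp [reachSet]

/-- Every vertex of a minimal separator has an in-neighbour on the side of the source. -/
theorem IsMinimalSeparator.exists_adj (h : G.IsMinimalSeparator D {v} T S) (hx : x ∈ S) :
    ∃ y, (G.delete S).Reach v y ∧ G.Adj y x := by
  obtain ⟨hT, hvT, hvS, hS, hsep⟩ := isSeparator_singleton.1 h.prop
  have hx' : ¬ G.IsSeparator D {v} T (S.erase x) := fun h' =>
    (Finset.notMem_erase x S) (h.le_of_le h' (Finset.erase_subset x S) hx)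
  rw [isSeparator_singleton] at hx'
  have : G.ReachesTerminal T (S.erase x) v := by
    by_contra hc
    exact hx' ⟨hT, hvT, fun h => hvS (Finset.mem_of_mem_erase h),
      (Finset.erase_subset x S).trans hS, hc⟩
  obtain ⟨t, ht, hr⟩ := this
  rcases hr.avoids_or_reaches hvS with h' | h'
  · exact absurd ⟨t, ht, h'⟩ hsep
  · exact h'

/-- If more can be reached from `v` after deleting `S'`, then a vertex of the minimal separator `S`
outside `S'` can be reached. -/
theorem IsMinimalSeparator.reach_of_subset (h : G.IsMinimalSeparator D {v} T S)
    (hsub : (G.delete S).reachSet {v} ⊆ (G.delete S').reachSet {v}) (hx : x ∈ S) (hx' : x ∉ S') :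
    (G.delete S').Reach v x := by
  obtain ⟨y, hy, hyx⟩ := h.exists_adj hx
  have := mem_reachSet_delete.1 (hsub (mem_reachSet_delete.2 hy))
  exact this.tail ⟨hyx, this.notMem_right, hx'⟩

/-- An important `v`–`T` separator that is a minimal `u`–`T` separator is an important `u`–`T`
separator. -/
theorem IsImportantSeparator.of_isMinimalSeparator (hv : G.IsImportantSeparator D {v} T S)
    (hu : G.IsMinimalSeparator D {u} T S) (hvV : v ∈ G.verts) :
    G.IsImportantSeparator D {u} T S := by
  classical
  refine ⟨hu, ?_⟩
  rintro ⟨S', hS', hcard, hlt⟩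
  obtain ⟨hT, huT, huS', hS'V, hsep'⟩ := isSeparator_singleton.1 hS'
  obtain ⟨-, hvT, hvS, hSV, hsep⟩ := isSeparator_singleton.1 hv.1.prop
  have hvr : (G.delete S).Reach v v := .refl (Finset.mem_sdiff.2 ⟨hvV, hvS⟩)
  -- If S' beats S for u, then S'' beats S for v. Nothing on the v-side of S is deleted, and a walk
  -- that leaves this side does so through a vertex of S∖S', which lies on the u-side of S' and
  -- hence cannot reach T.
  set S'' := S'.filter fun x => ¬ (G.delete S).Reach v x with hS''
  have hsub : S'' ⊆ S' := Finset.filter_subset _ _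
  have hmono : ∀ w, (G.delete S).Reach v w → (G.delete S'').Reach v w := by
    rintro w ⟨-, hw⟩
    have hv'' : (G.delete S'').Reach v v :=
      .refl (Finset.mem_sdiff.2 ⟨hvV, fun h => (Finset.mem_filter.1 h).2 hvr⟩)
    induction hw with
    | refl => exact hv''
    | tail h₁ h₂ ih =>
      exact ih.tail ⟨h₂.1, ih.notMem_right, fun h =>
        (Finset.mem_filter.1 h).2 ⟨hvr.1, h₁.tail h₂⟩⟩
  have hreach_or : ∀ w, (G.delete S'').Reach v w →
      (G.delete S).Reach v w ∨ (G.delete S').Reach u w := by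
    rintro w ⟨-, hw⟩
    induction hw with
    | refl => exact .inl hvr
    | @tail y z hy hyz ih =>
      by_cases hzS' : z ∈ S'
      · left
        by_contra hz
        exact hyz.2.2 (Finset.mem_filter.2 ⟨hzS', hz⟩)
      rcases ih with ih | ih
      · by_cases hzS : z ∈ S
        · exact .inr (hu.reach_of_subset hlt.1 hzS hzS')
        · exact .inl (ih.tail ⟨hyz.1, ih.notMem_right, hzS⟩)
      · exact .inr (ih.tail ⟨hyz.1, ih.notMem_right, hzS'⟩)
  refine hv.2 ⟨S'', isSeparator_singleton.2 ⟨hT, hvT, fun h => (Finset.mem_filter.1 h).2 hvr,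
    hsub.trans hS'V, ?_⟩, (Finset.card_le_card hsub).trans hcard, ?_⟩
  · rintro ⟨t, ht, h⟩
    rcases hreach_or t h with h | h
    · exact hsep ⟨t, ht, h⟩
    · exact hsep' ⟨t, ht, h⟩
  · refine (Set.ssubset_iff_of_subset fun w hw =>
      mem_reachSet_delete.2 (hmono w (mem_reachSet_delete.1 hw))).2 ?_
    have hne : ¬ S ⊆ S' := by
      intro hSS'
      rw [Finset.eq_of_subset_of_card_le hSS' hcard] at hlt
      exact hlt.2 subset_rfl
    obtain ⟨x, hxS, hxS'⟩ := Finset.not_subset.1 hne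
    refine ⟨x, mem_reachSet_delete.2 ?_, fun h => (mem_reachSet_delete.1 h).notMem_right hxS⟩
    obtain ⟨y, hy, hyx⟩ := hv.1.exists_adj hxS
    exact (hmono y hy).tail ⟨hyx, (hmono y hy).notMem_right, fun h => hxS' (hsub h)⟩

open scoped Classical in
/-- The set of vertices that can be reached from `v` in `G ∖ S`, as a `Finset`. -/
def reachFinset (G : FinDigraph V) (S : Finset V) (v : V) : Finset V :=
  G.verts.filter fun w => (G.delete S).Reach v w

theorem mem_reachFinset : b ∈ G.reachFinset S v ↔ (G.delete S).Reach v b := by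
  simp only [reachFinset, Finset.mem_filter, and_iff_right_iff_imp]
  exact fun h => (Finset.mem_sdiff.1 h.mem_right).1

/-- The separator is recovered from its reach set, so passing from separators to regions is
injective and keeps sizes. -/
theorem IsMinimalSeparator.outBoundary_reachFinset (h : G.IsMinimalSeparator D {v} T S) :
    G.outBoundary (G.reachFinset S v) = S := by
  ext x
  simp only [mem_outBoundary, mem_reachFinset]
  constructor
  · rintro ⟨hx, y, hy, hyx⟩
    by_contra hxS
    exact hx (hy.tail ⟨hyx, hy.notMem_right, hxS⟩)
  · intro hx
    exact ⟨fun h => h.notMem_right hx, h.exists_adj hx⟩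

theorem connFrom_reachFinset (hv : v ∈ G.verts \ S) : G.ConnFrom v (G.reachFinset S v) := by
  refine ⟨mem_reachFinset.2 (.refl hv), fun a ha => ?_⟩
  have ha' := (mem_reachFinset.1 ha).2
  clear ha
  induction ha' with
  | refl => exact .refl
  | tail h₁ h₂ ih =>
    exact ih.tail ⟨h₂.1, mem_reachFinset.2 ⟨hv, h₁⟩, mem_reachFinset.2 ⟨hv, h₁.tail h₂⟩⟩

/-- The boundary of a connected region B is a separator whose reach set is exactly B, so a larger
region with no larger boundary would refute importance. -/
theorem IsImportantSeparator.isImportantRegion (h : G.IsImportantSeparator D {v} T S)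
    (hv : v ∈ G.verts) : G.IsImportantRegion (T ∪ D) v T {v} (G.reachFinset S v) := by
  obtain ⟨hT, hvT, hvS, hSV, hsep⟩ := isSeparator_singleton.1 h.1.prop
  have hN := h.1.outBoundary_reachFinset
  have hdisj : Disjoint S (T ∪ D) := (Finset.disjoint_sdiff.mono_right hSV).symm
  have hconn : G.ConnFrom v (G.reachFinset S v) :=
    connFrom_reachFinset (Finset.mem_sdiff.2 ⟨hv, hvS⟩)
  refine ⟨⟨fun w hw => (Finset.mem_sdiff.1 (mem_reachFinset.1 hw).mem_right).1, Finset.singleton_subset_iff.2 hconn.1,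
    Finset.disjoint_left.2 fun t ht htT => hsep ⟨t, htT, mem_reachFinset.1 ht⟩, by rwa [hN]⟩,
    hconn, fun B hB hBc hlt => ?_⟩
  rw [hN, Finset.sdiff_eq_self_of_disjoint (hdisj.mono_right Finset.subset_union_left),
    Finset.sdiff_eq_self_of_disjoint (hB.2.2.2.mono_right Finset.subset_union_left)]
  by_contra! hle
  have hBr : ∀ w, (G.delete (G.outBoundary B)).Reach v w → w ∈ B := by
    rintro w ⟨-, hw⟩
    induction hw with
    | refl => exact hBc.1
    | tail h₁ h₂ ih =>
      by_contra hc
      exact h₂.2.2 (mem_outBoundary.2 ⟨hc, _, ih, h₂.1⟩)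
  have hrB : ∀ w ∈ B, (G.delete (G.outBoundary B)).Reach v w := by
    have hnot : ∀ w ∈ B, w ∉ G.outBoundary B := fun w hw h => (mem_outBoundary.1 h).1 hw
    exact fun w hw => ⟨Finset.mem_sdiff.2 ⟨hv, hnot v hBc.1⟩,
      (hBc.2 w hw).lift id fun _ _ h => ⟨h.1, hnot _ h.2.1, hnot _ h.2.2⟩⟩
  refine h.2 ⟨G.outBoundary B, isSeparator_singleton.2 ⟨hT, hvT,
    fun h => (mem_outBoundary.1 h).1 hBc.1, fun x hx => Finset.mem_sdiff.2
      ⟨outBoundary_subset_verts B hx, Finset.disjoint_left.1 hB.2.2.2 hx⟩, ?_⟩, hle, ?_⟩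
  · rintro ⟨t, ht, h⟩
    exact Finset.disjoint_left.1 hB.2.2.1 (hBr t h) ht
  · have h₁ : (G.delete S).reachSet {v} = (G.reachFinset S v : Set V) := by
      ext w
      rw [mem_reachSet_delete, Finset.mem_coe, mem_reachFinset]
    have h₂ : (G.delete (G.outBoundary B)).reachSet {v} = (B : Set V) := by
      ext w
      rw [mem_reachSet_delete, Finset.mem_coe]
      exact ⟨hBr w, hrB w⟩
    rw [h₁, h₂]
    exact_mod_cast hlt

open scoped Classical in
/-- There are at most `4 ^ k` important `v`–`T` separators of size at most `k`. -/
theorem card_importantSeparators_le (G : FinDigraph V) (D T : Finset V) (v : V)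
    (hv : v ∈ G.verts) (k : ℕ) :
    (G.verts.powerset.filter fun S =>
      S.card ≤ k ∧ G.IsImportantSeparator D {v} T S).card ≤ 4 ^ k := by
  refine (Finset.card_le_card_of_injOn (fun S => G.reachFinset S v) (fun S hS => ?_)
    fun S hS S' hS' h => ?_).trans (G.card_importantRegions_le (T ∪ D) T v k)
  · simp only [Finset.coe_filter, Set.mem_ofPred_eq] at hS
    refine mem_importantRegions.2 ⟨hS.2.2.isImportantRegion hv, ?_⟩
    rw [hS.2.2.1.outBoundary_reachFinset]
    exact (Finset.card_le_card Finset.sdiff_subset).trans hS.2.1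
  · simp only [Finset.coe_filter, Set.mem_ofPred_eq] at hS hS'
    rw [← hS.2.2.1.outBoundary_reachFinset, ← hS'.2.2.1.outBoundary_reachFinset]
    exact congrArg _ h

end FinDigraph

/-! ### Pushing solutions towards the terminals; extremal solutions -/

namespace FinDigraph

variable {V : Type u} [DecidableEq V] {G : FinDigraph V} {D T S S₁ S₂ : Finset V} {a b u v x : V}

/-- A path that avoids the pushed set but meets S meets it in S₁∖S₂. From there no terminal is
reachable past S₂, although b reaches one. -/
theorem reach_of_push (hpush : ∀ x ∈ S₁ \ S₂, ¬ G.ReachesTerminal T S₂ x)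
    (h : (G.delete (S \ S₁ ∪ S₂)).Reach a b) (hb : G.ReachesTerminal T (S \ S₁ ∪ S₂) b) :
    (G.delete S).Reach a b := by
  refine (h.avoids_or_meets S).resolve_right ?_
  rintro ⟨x, hx, h₁, h₂⟩
  obtain ⟨t, ht, hbt⟩ := hb
  have hx' := h₁.notMem_right
  simp only [Finset.mem_union, Finset.mem_sdiff, not_or, not_and, not_not] at hx'
  exact hpush x (Finset.mem_sdiff.2 ⟨hx'.1 hx, hx'.2⟩)
    ⟨t, ht, (h₂.trans hbt).mono Finset.subset_union_right⟩

end FinDigraph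

namespace DirectedInstance

variable {V : Type u} [DecidableEq V] {I : DirectedInstance V} {S S₁ S₂ : Finset V} {v x : V}

theorem IsSolution.disjoint_distinguished (hS : I.IsSolution S) : Disjoint S I.distinguished :=
  (Finset.disjoint_sdiff.mono_right hS.1).symm

theorem IsSolution.notMem_of_mem_terminals (hS : I.IsSolution S) (hI : I.WellFormed)
    (hv : v ∈ I.terminals) : v ∉ S := fun h =>
  Finset.disjoint_left.1 hS.disjoint_distinguished h (hI.1 hv)

/-- A vertex of the solution `S` that is needed: `S` without it is not a solution. -/
theorem IsSolution.reachesTerminal_erase (hS : I.IsSolution S)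
    (hx : x ∈ S) (h : ¬ I.IsSolution (S.erase x)) :
    I.graph.ReachesTerminal I.terminals (S.erase x) x ∧
      I.graph.reverse.ReachesTerminal I.terminals (S.erase x) x := by
  have : ∃ s ∈ I.terminals, ∃ t ∈ I.terminals, s ≠ t ∧
      (I.graph.delete (S.erase x)).Reach s t := by
    by_contra! hc
    exact h ⟨(Finset.erase_subset x S).trans hS.1,
      (Finset.card_le_card (Finset.erase_subset x S)).trans hS.2.1, hc⟩
  obtain ⟨s, hs, t, ht, hst, hr⟩ := this
  rcases hr.avoids_or_meets S with h' | ⟨y, hy, h₁, h₂⟩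
  · exact absurd h' (hS.2.2 s hs t ht hst)
  · have hyx : y = x := by
      by_contra hne
      exact h₁.notMem_right (Finset.mem_erase.2 ⟨hne, hy⟩)
    subst hyx
    exact ⟨⟨t, ht, h₂⟩, ⟨s, hs, FinDigraph.reach_delete_reverse.2 h₁⟩⟩

/-- Pushing: if no important `v`–`T` separator is contained in the solution `S`, although `S`
separates `v` from `T`, then there is another solution of at most the same size, for which no
further vertex reaches `T` or becomes live, and which contains a vertex that reaches `T` in
`G ∖ S`. -/
theorem IsSolution.exists_push (hS : I.IsSolution S) (hI : I.WellFormed)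
    (hT : I.terminals.Nonempty)
    (hthin : ∀ x ∈ S, I.graph.ReachesTerminal I.terminals (S.erase x) x)
    (hvS : v ∉ S) (hvT : v ∉ I.terminals) (hv : ¬ I.graph.ReachesTerminal I.terminals S v)
    (hno : ∀ S₁ ⊆ S, ¬ I.graph.IsImportantSeparator I.distinguished {v} I.terminals S₁) :
    ∃ S', I.IsSolution S' ∧ S'.card ≤ S.card ∧
      (∀ u, I.graph.IsLive I.terminals S' u → I.graph.IsLive I.terminals S u) ∧
      (∀ u, I.graph.ReachesTerminal I.terminals S' u → I.graph.ReachesTerminal I.terminals S u) ∧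
      ∃ y ∈ S', I.graph.ReachesTerminal I.terminals S y := by
  have hSV : S ⊆ I.graph.verts \ (I.terminals ∪ I.distinguished) := by
    rw [Finset.union_eq_right.2 hI.1]
    exact hS.1
  obtain ⟨S₁, hS₁S, hmin⟩ := exists_minimal_le_of_wellFoundedLT
    (I.graph.IsSeparator I.distinguished {v} I.terminals) S
    (FinDigraph.isSeparator_singleton.2 ⟨hT, hvT, hvS, hSV, hv⟩)
  have hnimp := hno S₁ hS₁S
  have : ∃ S₂ : Finset V, I.graph.IsSeparator I.distinguished {v} I.terminals S₂ ∧
      S₂.card ≤ S₁.card ∧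
      (I.graph.delete S₁).reachSet {v} ⊂ (I.graph.delete S₂).reachSet {v} := by
    by_contra hc
    exact hnimp ⟨hmin, hc⟩
  obtain ⟨S₂, hS₂, hcard, hlt⟩ := this
  obtain ⟨-, -, -, hS₂V, hsep⟩ := FinDigraph.isSeparator_singleton.1 hS₂
  have hpush : ∀ x ∈ S₁ \ S₂, ¬ I.graph.ReachesTerminal I.terminals S₂ x := by
    rintro x hx ⟨t, ht, h⟩
    obtain ⟨hx₁, hx₂⟩ := Finset.mem_sdiff.1 hx
    exact hsep ⟨t, ht, (FinDigraph.IsMinimalSeparator.reach_of_subset hmin hlt.1 hx₁ hx₂).trans h⟩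
  have hto : ∀ u, I.graph.ReachesTerminal I.terminals (S \ S₁ ∪ S₂) u →
      I.graph.ReachesTerminal I.terminals S u := by
    rintro u ⟨t, ht, h⟩
    exact ⟨t, ht, FinDigraph.reach_of_push hpush h ⟨t, ht, .refl h.mem_right⟩⟩
  refine ⟨S \ S₁ ∪ S₂, ⟨?_, ?_, ?_⟩, ?_, ?_, hto, ?_⟩
  · refine Finset.union_subset (Finset.sdiff_subset.trans hS.1) (hS₂V.trans ?_)
    exact Finset.sdiff_subset_sdiff le_rfl Finset.subset_union_right
  · refine (Finset.card_union_le _ _).trans (le_trans ?_ hS.2.1)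
    rw [Finset.card_sdiff_of_subset hS₁S]
    have := Finset.card_le_card hS₁S
    omega
  · intro s hs t ht hst h
    exact hS.2.2 s hs t ht hst
      (FinDigraph.reach_of_push hpush h ⟨t, ht, .refl h.mem_right⟩)
  · refine (Finset.card_union_le _ _).trans ?_
    rw [Finset.card_sdiff_of_subset hS₁S]
    have := Finset.card_le_card hS₁S
    omega
  · rintro u ⟨h₁, s, hs, h₂⟩
    exact ⟨hto u h₁, s, hs, FinDigraph.reach_delete_reverse.2
      (FinDigraph.reach_of_push hpush (FinDigraph.reach_delete_reverse.1 h₂) h₁)⟩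
  -- For x ∈ S₁∖S₂, some path from x to T avoids S after its last visit to x. Since x cannot reach T
  -- past S₂, this path meets S₂, and the meeting vertex reaches T in G∖S.
  · have hne : ¬ S₁ ⊆ S₂ := by
      intro h
      refine hlt.2 fun w hw => ?_
      rw [FinDigraph.mem_reachSet_delete] at hw ⊢
      exact hw.mono h
    obtain ⟨x, hx₁, hx₂⟩ := Finset.not_subset.1 hne
    have hx := hpush x (Finset.mem_sdiff.2 ⟨hx₁, hx₂⟩)
    obtain ⟨t, ht, hxt⟩ := hthin x (hS₁S hx₁)
    rcases hxt.avoids_or_leaves (hS.notMem_of_mem_terminals hI ht) with h | ⟨z, hxz, hzt⟩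
    · exact absurd (hS₁S hx₁) h.notMem_left
    by_cases hz : z ∈ S₂
    · exact ⟨z, Finset.mem_union_right _ hz, t, ht, hzt⟩
    rcases hzt.avoids_or_meets S₂ with h | ⟨y, hy, -, hyt⟩
    · exact absurd ⟨t, ht, h.head ⟨hxz, hx₂, hz⟩⟩ hx
    · exact ⟨y, Finset.mem_union_right _ hy, t, ht, hyt⟩

/-- A solution that is extremal in the following sense can be found by both sampling phases. -/
structure IsExtremalSolution (I : DirectedInstance V) (S : Finset V) : Prop where
  isSolution : I.IsSolution S
  card_le : ∀ S', I.IsSolution S' → S.card ≤ S'.card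
  live_of_live : ∀ S', I.IsSolution S' → S'.card ≤ S.card →
    (∀ u, I.graph.IsLive I.terminals S' u → I.graph.IsLive I.terminals S u) →
    ∀ u, I.graph.IsLive I.terminals S u → I.graph.IsLive I.terminals S' u
  reaches_of_reaches : ∀ S', I.IsSolution S' → S'.card ≤ S.card →
    (∀ u, I.graph.IsLive I.terminals S' u → I.graph.IsLive I.terminals S u) →
    (∀ u, I.graph.ReachesTerminal I.terminals S' u → I.graph.ReachesTerminal I.terminals S u) →
    ∀ u, I.graph.ReachesTerminal I.terminals S u → I.graph.ReachesTerminal I.terminals S' u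

/-- A lexicographic minimum. Live vertices are counted before those that reach T because liveness is
invariant under reversal, whereas a push in the reversed graph gives no control over forward
reachability. -/
theorem exists_isExtremalSolution (h : I.IsYes) : ∃ S, I.IsExtremalSolution S := by
  classical
  let live (S : Finset V) := I.graph.verts.filter fun u => I.graph.IsLive I.terminals S u
  let reaches (S : Finset V) :=
    I.graph.verts.filter fun u => I.graph.ReachesTerminal I.terminals S u
  have hV : ∀ {S u}, I.graph.ReachesTerminal I.terminals S u → u ∈ I.graph.verts :=
    fun ⟨_, _, h⟩ => (Finset.mem_sdiff.1 h.1).1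
  let f (S : Finset V) : ℕ ×ₗ ℕ ×ₗ ℕ :=
    toLex (S.card, toLex ((live S).card, (reaches S).card))
  obtain ⟨S, hS, hmin⟩ := WellFounded.has_min (InvImage.wf f wellFounded_lt)
    {S | I.IsSolution S} h
  have hmin' : ∀ S', I.IsSolution S' → S.card < S'.card ∨ S.card = S'.card ∧
      ((live S).card < (live S').card ∨ (live S).card = (live S').card ∧
        (reaches S).card ≤ (reaches S').card) := by
    intro S' hS'
    have : f S ≤ f S' := not_lt.1 (hmin S' hS')
    simpa only [f, Prod.Lex.toLex_le_toLex] using this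
  refine ⟨S, hS, fun S' hS' => ?_, fun S' hS' hc hl u hu => ?_, fun S' hS' hc hl hr u hu => ?_⟩
  · have := hmin' S' hS'
    omega
  · have hsub : live S' ⊆ live S := Finset.monotone_filter_right _ fun u _ => hl u
    have h₁ := hmin' S' hS'
    have h₂ := Finset.card_le_card hsub
    have heq := Finset.eq_of_subset_of_card_le hsub (by omega)
    have : u ∈ live S := Finset.mem_filter.2 ⟨hV hu.1, hu⟩
    rw [← heq] at this
    exact (Finset.mem_filter.1 this).2
  · have hsub : live S' ⊆ live S := Finset.monotone_filter_right _ fun u _ => hl u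
    have hsub' : reaches S' ⊆ reaches S := Finset.monotone_filter_right _ fun u _ => hr u
    have h₁ := hmin' S' hS'
    have h₂ := Finset.card_le_card hsub
    have h₃ := Finset.card_le_card hsub'
    have heq := Finset.eq_of_subset_of_card_le hsub' (by omega)
    have : u ∈ reaches S := Finset.mem_filter.2 ⟨hV hu, hu⟩
    rw [← heq] at this
    exact (Finset.mem_filter.1 this).2

/-- `S` can be found by a run of `RandomSet`: it is a solution, none of its vertices is separated
from the terminals by the others, and an important separator inside `S` separates every vertex that
`S` separates from the terminals. -/
structure IsSampleable (I : DirectedInstance V) (S : Finset V) : Prop where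
  isSolution : I.IsSolution S
  thin : ∀ x ∈ S, I.graph.ReachesTerminal I.terminals (S.erase x) x
  exists_important : ∀ v ∈ I.graph.verts, v ∉ S → ¬ I.graph.ReachesTerminal I.terminals S v →
    ∃ S₁ ⊆ S, I.graph.IsImportantSeparator I.distinguished {v} I.terminals S₁

theorem IsExtremalSolution.reachesTerminal_erase (hS : I.IsExtremalSolution S)
    (hx : x ∈ S) :
    I.graph.ReachesTerminal I.terminals (S.erase x) x ∧
      I.graph.reverse.ReachesTerminal I.terminals (S.erase x) x :=
  hS.isSolution.reachesTerminal_erase hx fun h =>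
    (hS.card_le _ h).not_gt (Finset.card_erase_lt_of_mem hx)

theorem IsSolution.reachesTerminal_of_mem (hS : I.IsSolution S) (hI : I.WellFormed)
    (hv : v ∈ I.terminals) : I.graph.ReachesTerminal I.terminals S v :=
  ⟨v, hv, .refl (Finset.mem_sdiff.2 ⟨hI.2 (hI.1 hv), hS.notMem_of_mem_terminals hI hv⟩)⟩

/-- A push would delete a vertex that reaches T in G∖S, while extremality demands that this vertex
still reach T afterwards. -/
theorem IsExtremalSolution.isSampleable (hS : I.IsExtremalSolution S) (hI : I.WellFormed)
    (hT : I.terminals.Nonempty) : I.IsSampleable S := by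
  have hthin : ∀ x ∈ S, I.graph.ReachesTerminal I.terminals (S.erase x) x := fun x hx =>
    (hS.reachesTerminal_erase hx).1
  refine ⟨hS.isSolution, hthin, fun v _ hvS hvr => ?_⟩
  by_contra! hno
  have hvT : v ∉ I.terminals := fun h => hvr (hS.isSolution.reachesTerminal_of_mem hI h)
  obtain ⟨S', hS', hc, hl, hr, y, hy, hyr⟩ :=
    hS.isSolution.exists_push hI hT hthin hvS hvT hvr hno
  exact (hS.reaches_of_reaches S' hS' hc hl hr y hyr).notMem hy

theorem isSolution_reverseWith {Z : Finset V} :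
    (I.reverseWith Z).IsSolution S ↔ I.IsSolution S ∧ Disjoint S Z := by
  have hr : (∀ s ∈ I.terminals, ∀ t ∈ I.terminals, s ≠ t →
      ¬ (I.graph.reverse.delete S).Reach s t) ↔
      ∀ s ∈ I.terminals, ∀ t ∈ I.terminals, s ≠ t → ¬ (I.graph.delete S).Reach s t := by
    simp only [FinDigraph.reach_delete_reverse]
    exact ⟨fun h s hs t ht hst => h t ht s hs hst.symm, fun h s hs t ht hst => h t ht s hs hst.symm⟩
  have hsub : S ⊆ I.graph.verts \ (I.distinguished ∪ Z) ↔
      S ⊆ I.graph.verts \ I.distinguished ∧ Disjoint S Z := by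
    simp only [Finset.subset_iff, Finset.disjoint_left, Finset.mem_sdiff, Finset.mem_union]
    grind
  have hunfold : (I.reverseWith Z).IsSolution S ↔
      S ⊆ I.graph.verts \ (I.distinguished ∪ Z) ∧ S.card ≤ I.budget ∧
        ∀ s ∈ I.terminals, ∀ t ∈ I.terminals, s ≠ t →
          ¬ (I.graph.reverse.delete S).Reach s t := Iff.rfl
  rw [hunfold, hsub, hr, IsSolution]
  tauto

theorem WellFormed.reverseWith (hI : I.WellFormed) {Z : Finset V} (hZ : Z ⊆ I.graph.verts) :
    (I.reverseWith Z).WellFormed :=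
  ⟨hI.1.trans Finset.subset_union_left, Finset.union_subset hI.2 hZ⟩

/-- A push in the reversed graph deletes a vertex y that is reachable from T in G∖S. As y avoids the
undeletable set Z, which covers whatever cannot reach T, y is live for S. Deleting it contradicts
minimality of the live set. -/
theorem IsExtremalSolution.isSampleable_reverseWith (hS : I.IsExtremalSolution S)
    (hI : I.WellFormed) (hT : I.terminals.Nonempty) {Z : Finset V} (hZ : Z ⊆ I.graph.verts)
    (hSZ : Disjoint S Z)
    (hcov : ∀ v ∈ I.graph.verts, v ∉ S → ¬ I.graph.ReachesTerminal I.terminals S v → v ∈ Z) :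
    (I.reverseWith Z).IsSampleable S := by
  have hsol := isSolution_reverseWith.2 ⟨hS.isSolution, hSZ⟩
  have hthin : ∀ x ∈ S, I.graph.reverse.ReachesTerminal I.terminals (S.erase x) x := fun x hx =>
    (hS.reachesTerminal_erase hx).2
  refine ⟨hsol, hthin, fun v _ hvS hvr => ?_⟩
  by_contra! hno
  have hvT : v ∉ I.terminals := fun h => hvr (hsol.reachesTerminal_of_mem (hI.reverseWith hZ) h)
  obtain ⟨S', hS', hc, hl, hr, y, hy, hyr⟩ :=
    hsol.exists_push (hI.reverseWith hZ) hT hthin hvS hvT hvr hno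
  obtain ⟨hS', hS'Z⟩ := isSolution_reverseWith.1 hS'
  have hyV : y ∈ I.graph.verts := (Finset.mem_sdiff.1 (hS'.1 hy)).1
  have hyS : y ∉ S := hyr.notMem
  have hy₁ : I.graph.ReachesTerminal I.terminals S y := by
    by_contra hc
    exact Finset.disjoint_left.1 hS'Z hy (hcov y hyV hyS hc)
  exact (hS.live_of_live S' hS' hc (fun u hu => FinDigraph.isLive_reverse.1
    (hl u (FinDigraph.isLive_reverse.2 hu))) y ⟨hy₁, hyr⟩).1.notMem hy

end DirectedInstance

/-! ### Success probability of one run of RandomSet -/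

/-- A uniformly random subset of `X` contains `A` and avoids `B` with probability at least
`2 ^ -(|A| + |B|)`. -/
theorem PMF.le_toOuterMeasure_uniformOfFinset_powerset {α : Type*} [DecidableEq α]
    {X A B : Finset α} (hA : A ⊆ X) (hAB : Disjoint A B) :
    ((2 : ℝ≥0∞) ^ (A.card + B.card))⁻¹ ≤
      (PMF.uniformOfFinset X.powerset (Finset.powerset_nonempty _)).toOuterMeasure
        {Y | Y ⊆ X ∧ A ⊆ Y ∧ Disjoint Y B} := by
  classical
  rw [PMF.toOuterMeasure_uniformOfFinset_apply, Finset.card_powerset]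
  set E := X.powerset.filter (· ∈ {Y | Y ⊆ X ∧ A ⊆ Y ∧ Disjoint Y B}) with hE
  have hcard : 2 ^ X.card ≤ 2 ^ (A.card + B.card) * E.card := by
    -- The choices outside A ∪ B are free: Y ↦ Y ∪ A injects them into the event.
    have h₁ : (X \ (A ∪ B)).powerset.card ≤ E.card := by
      refine Finset.card_le_card_of_injOn (fun Y => Y ∪ A) (fun Y hY => ?_)
        fun Y hY Y' hY' h => ?_
      · have hY := Finset.mem_powerset.1 hY
        have hYX := hY.trans Finset.sdiff_subset
        have hYAB : Disjoint Y (A ∪ B) := (Finset.disjoint_sdiff.mono_right hY).symm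
        simp only [hE, Finset.coe_filter, Finset.mem_powerset, Set.mem_ofPred_eq]
        exact ⟨Finset.union_subset hYX hA, Finset.union_subset hYX hA,
          Finset.subset_union_right,
          Finset.disjoint_union_left.2 ⟨hYAB.mono_right Finset.subset_union_right, hAB⟩⟩
      · have key : ∀ Z ∈ (X \ (A ∪ B)).powerset, (Z ∪ A) \ A = Z := by
          intro Z hZ
          have hZA : Disjoint Z A :=
            ((Finset.disjoint_sdiff.mono_right (Finset.mem_powerset.1 hZ)).symm).mono_right
              Finset.subset_union_left
          rw [Finset.union_sdiff_right, Finset.sdiff_eq_self_of_disjoint hZA]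
        rw [← key Y hY, ← key Y' hY']
        exact congrArg (· \ A) h
    have h₂ : X.card ≤ (A.card + B.card) + (X \ (A ∪ B)).card := by
      have := Finset.card_le_card_sdiff_add_card (s := X) (t := A ∪ B)
      have := Finset.card_union_le A B
      omega
    calc 2 ^ X.card ≤ 2 ^ ((A.card + B.card) + (X \ (A ∪ B)).card) :=
          Nat.pow_le_pow_right two_pos h₂
      _ = 2 ^ (A.card + B.card) * (X \ (A ∪ B)).powerset.card := by
          rw [pow_add, Finset.card_powerset]
      _ ≤ _ := Nat.mul_le_mul_left _ h₁
  rw [ENNReal.le_div_iff_mul_le (by simp) (by simp), ENNReal.inv_mul_le_iff (by simp) (by simp)]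
  norm_cast
  convert hcard

theorem PMF.mul_le_toOuterMeasure_bind {α β : Type*} (p : PMF α) (f : α → PMF β) {E : Set α}
    {s : Set β} {c : ℝ≥0∞} (h : ∀ a ∈ E, c ≤ (f a).toOuterMeasure s) :
    p.toOuterMeasure E * c ≤ (p.bind f).toOuterMeasure s := by
  rw [PMF.toOuterMeasure_bind_apply, PMF.toOuterMeasure_apply, ← ENNReal.tsum_mul_right]
  refine ENNReal.tsum_le_tsum fun a => ?_
  by_cases ha : a ∈ E
  · rw [Set.indicator_of_mem ha]
    exact mul_le_mul_right (h a ha) _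
  · simp [Set.indicator_of_notMem ha]

namespace DirectedInstance

variable {V : Type u} [DecidableEq V] {I : DirectedInstance V} {S X Z : Finset V} {v x : V}

theorem mem_importantSeparators : S ∈ I.importantSeparators ↔ S.card ≤ I.budget ∧
    ∃ v ∈ I.graph.verts \ I.terminals,
      I.graph.IsImportantSeparator I.distinguished {v} I.terminals S := by
  simp only [importantSeparators, Finset.mem_filter, Finset.mem_powerset, and_iff_right_iff_imp]
  rintro ⟨-, v, -, h⟩
  exact h.1.prop.2.2.2.1.trans Finset.sdiff_subset

theorem mem_exactReverseShadow : v ∈ I.exactReverseShadow S ↔ v ∈ I.graph.verts ∧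
    I.graph.IsMinimalSeparator I.distinguished {v} I.terminals S := by
  simp only [exactReverseShadow, Finset.mem_filter]

theorem subset_of_mem_exactShadows (hX : X ∈ I.exactShadows) :
    X ⊆ I.graph.verts \ I.terminals := by
  obtain ⟨S, -, rfl⟩ := Finset.mem_image.1 hX
  intro v hv
  obtain ⟨hv, h⟩ := mem_exactReverseShadow.1 hv
  exact Finset.mem_sdiff.2 ⟨hv, (FinDigraph.isSeparator_singleton.1 h.prop).2.1⟩

theorem sup_subset_of_subset_exactShadows {X' : Finset (Finset V)} (h : X' ⊆ I.exactShadows) :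
    X'.sup id ⊆ I.graph.verts \ I.terminals :=
  Finset.sup_le fun _ hX => subset_of_mem_exactShadows (h hX)

open scoped Classical in
/-- The exact reverse shadows of the important separators inside `S`. -/
def shadowsWithin (I : DirectedInstance V) (S : Finset V) : Finset (Finset V) :=
  (I.importantSeparators.filter (· ⊆ S)).image I.exactReverseShadow

open scoped Classical in
/-- The exact reverse shadows that meet `S`. -/
def shadowsMeeting (I : DirectedInstance V) (S : Finset V) : Finset (Finset V) :=
  I.exactShadows.filter fun X => ¬ Disjoint X S

theorem mem_shadowsWithin : X ∈ I.shadowsWithin S ↔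
    ∃ S₁ ∈ I.importantSeparators, S₁ ⊆ S ∧ I.exactReverseShadow S₁ = X := by
  simp only [shadowsWithin, Finset.mem_image, Finset.mem_filter, and_assoc]

theorem mem_shadowsMeeting :
    X ∈ I.shadowsMeeting S ↔ X ∈ I.exactShadows ∧ ¬ Disjoint X S := by
  simp only [shadowsMeeting, Finset.mem_filter]

theorem shadowsWithin_subset (S : Finset V) : I.shadowsWithin S ⊆ I.exactShadows := by
  intro X hX
  obtain ⟨S₁, h, -, rfl⟩ := mem_shadowsWithin.1 hX
  exact Finset.mem_image_of_mem _ h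

theorem card_shadowsWithin_le (S : Finset V) : (I.shadowsWithin S).card ≤ 2 ^ S.card := by
  classical
  rw [← Finset.card_powerset]
  refine Finset.card_image_le.trans (Finset.card_le_card fun S₁ h => ?_)
  exact Finset.mem_powerset.2 (Finset.mem_filter.1 h).2

/-- Charge a shadow to a vertex x of S in it. The underlying separator is a minimal x–T separator
and important for some v, hence important for x. -/
theorem card_shadowsMeeting_le (hS : S ⊆ I.graph.verts) :
    (I.shadowsMeeting S).card ≤ S.card * 4 ^ I.budget := by
  classical
  have hsub : I.shadowsMeeting S ⊆ S.biUnion fun x =>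
      (I.graph.verts.powerset.filter fun S₁ => S₁.card ≤ I.budget ∧
        I.graph.IsImportantSeparator I.distinguished {x} I.terminals S₁).image
          I.exactReverseShadow := by
    intro X hX
    obtain ⟨hX, hXS⟩ := mem_shadowsMeeting.1 hX
    obtain ⟨S₁, hS₁, rfl⟩ := Finset.mem_image.1 hX
    obtain ⟨x, hx, hxS⟩ := Finset.not_disjoint_iff.1 hXS
    obtain ⟨hxV, hx⟩ := mem_exactReverseShadow.1 hx
    obtain ⟨hcard, v, hv, himp⟩ := mem_importantSeparators.1 hS₁
    refine Finset.mem_biUnion.2 ⟨x, hxS, Finset.mem_image_of_mem _ (Finset.mem_filter.2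
      ⟨Finset.mem_powerset.2 (hx.prop.2.2.2.1.trans Finset.sdiff_subset), hcard, ?_⟩)⟩
    exact himp.of_isMinimalSeparator hx (Finset.mem_sdiff.1 hv).1
  refine (Finset.card_le_card hsub).trans (Finset.card_biUnion_le_card_mul _ _ _ fun x hx => ?_)
  refine Finset.card_image_le.trans ?_
  exact I.graph.card_importantSeparators_le I.distinguished I.terminals x (hS hx) I.budget

/-- If x ∈ S lay in the shadow of S₁ ⊆ S, then S₁ ⊆ S∖{x} would separate x from T, against thinness.
So no shadow must be both selected and rejected. -/
theorem IsSampleable.disjoint_of_mem_shadowsWithin (hS : I.IsSampleable S)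
    (hX : X ∈ I.shadowsWithin S) : Disjoint X S := by
  obtain ⟨S₁, -, hS₁S, rfl⟩ := mem_shadowsWithin.1 hX
  refine Finset.disjoint_left.2 fun x hx hxS => ?_
  obtain ⟨-, -, hxS₁, -, hsep⟩ :=
    FinDigraph.isSeparator_singleton.1 (mem_exactReverseShadow.1 hx).2.prop
  obtain ⟨t, ht, h⟩ := hS.thin x hxS
  exact hsep ⟨t, ht, h.mono fun y hy =>
    Finset.mem_erase.2 ⟨fun hyx => hxS₁ (hyx ▸ hy), hS₁S hy⟩⟩

/-- `Z` avoids `S` and the terminals, and contains all vertices that `S` separates from the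
terminals. -/
def IsGoodSample (I : DirectedInstance V) (S Z : Finset V) : Prop :=
  Z ⊆ I.graph.verts \ I.terminals ∧ Disjoint S Z ∧
    ∀ v ∈ I.graph.verts, v ∉ S → ¬ I.graph.ReachesTerminal I.terminals S v → v ∈ Z

/-- It suffices to select all shadows from within S and none that meets S. The number of prescribed
choices is at most (p+1)·4^p ≤ 2^(3p). -/
theorem IsSampleable.le_toOuterMeasure_randomSet (hS : I.IsSampleable S) (hI : I.WellFormed) :
    ((2 : ℝ≥0∞) ^ 2 ^ (3 * I.budget))⁻¹ ≤
      I.randomSet.toOuterMeasure {Z | I.IsGoodSample S Z} := by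
  classical
  have hdisj : Disjoint (I.shadowsWithin S) (I.shadowsMeeting S) :=
    Finset.disjoint_left.2 fun X h₁ h₂ =>
      (mem_shadowsMeeting.1 h₂).2 (hS.disjoint_of_mem_shadowsWithin h₁)
  have hcard : (I.shadowsWithin S).card + (I.shadowsMeeting S).card ≤ 2 ^ (3 * I.budget) := by
    have h₁ : (I.shadowsWithin S).card ≤ 4 ^ I.budget :=
      (card_shadowsWithin_le S).trans ((Nat.pow_le_pow_right two_pos hS.isSolution.2.1).trans
        (Nat.pow_le_pow_left (by norm_num) _))
    have h₂ : (I.shadowsMeeting S).card ≤ I.budget * 4 ^ I.budget :=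
      (card_shadowsMeeting_le (hS.isSolution.1.trans Finset.sdiff_subset)).trans
        (Nat.mul_le_mul_right _ hS.isSolution.2.1)
    have h₃ : I.budget + 1 ≤ 2 ^ I.budget := Nat.lt_two_pow_self
    calc _ ≤ (I.budget + 1) * 4 ^ I.budget := by linarith
      _ ≤ 2 ^ I.budget * 4 ^ I.budget := Nat.mul_le_mul_right _ h₃
      _ = 2 ^ (3 * I.budget) := by rw [← mul_pow, pow_mul]; norm_num
  refine (ENNReal.inv_le_inv.2 (pow_le_pow_right₀ one_le_two hcard)).trans
    ((PMF.le_toOuterMeasure_uniformOfFinset_powerset (shadowsWithin_subset S) hdisj).trans ?_)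
  rw [randomSet, PMF.toOuterMeasure_map_apply]
  refine MeasureTheory.measure_mono ?_
  rintro X' ⟨hX', hA, hB⟩
  refine ⟨sup_subset_of_subset_exactShadows hX', ?_, fun v hv hvS hvr => ?_⟩
  · refine (Finset.disjoint_sup_left.2 fun X hX => ?_).symm
    by_contra hc
    exact Finset.disjoint_left.1 hB hX (mem_shadowsMeeting.2 ⟨hX' hX, hc⟩)
  · obtain ⟨S₁, hS₁S, himp⟩ := hS.exists_important v hv hvS hvr
    have hvT : v ∉ I.terminals := fun h => hvr (hS.isSolution.reachesTerminal_of_mem hI h)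
    have hmem : I.exactReverseShadow S₁ ∈ X' := hA (mem_shadowsWithin.2
      ⟨S₁, mem_importantSeparators.2 ⟨(Finset.card_le_card hS₁S).trans hS.isSolution.2.1, v,
        Finset.mem_sdiff.2 ⟨hv, hvT⟩, himp⟩, hS₁S, rfl⟩)
    exact Finset.le_sup (f := id) hmem (mem_exactReverseShadow.2 ⟨hv, himp.1⟩)

end DirectedInstance

/-! ### Paths of the digraph and walks of the torso -/

namespace FinDigraph

variable {V : Type u} [DecidableEq V] {G : FinDigraph V} {C S : Finset V} {a b t : V}

theorem reach_delete_of_isChain {l : List V} (hl : ∀ x ∈ l, x ∉ S) (ha : a ∉ S) (hb : b ∉ S)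
    (h : List.IsChain G.Adj (a :: (l ++ [b]))) : (G.delete S).Reach a b := by
  induction l generalizing a with
  | nil =>
    have hab : G.Adj a b := by simpa using h
    exact ⟨Finset.mem_sdiff.2 ⟨(G.mem_of_adj hab).1, ha⟩, .single ⟨hab, ha, hb⟩⟩
  | cons c l ih =>
    rw [List.cons_append, List.isChain_cons_cons] at h
    have hc := hl c (by simp)
    exact (ih (fun x hx => hl x (by simp [hx])) hc h.2).head ⟨h.1, ha, hc⟩

theorem reach_delete_of_torso_adj (hS : S ⊆ C) (h : (G.torso C).Adj a b) (ha : a ∉ S)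
    (hb : b ∉ S) : (G.delete S).Reach a b := by
  obtain ⟨-, -, l, hl, hchain⟩ := h
  exact reach_delete_of_isChain (fun x hx hxS => hl x hx (hS hxS)) ha hb hchain

/-- A path of `G ∖ S` between vertices of the torso gives a walk in the underlying graph of the
torso. -/
theorem exists_torso_walk (h : (G.delete S).Reach a t) (ha : a ∈ C) (ht : t ∈ C) :
    ∃ w : (SimpleGraph.fromRel (G.torso C).Adj).Walk a t, ∀ x ∈ w.support, x ∉ S := by
  have htS := h.notMem_right
  -- The induction runs through start vertices outside C, so the claim concerns the first vertex c
  -- of C on the path.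
  have key : ∃ c ∈ C, (∃ w : (SimpleGraph.fromRel (G.torso C).Adj).Walk c t,
      ∀ x ∈ w.support, x ∉ S) ∧ (a = c ∨ a ∉ C ∧ ∃ l : List V, (∀ x ∈ l, x ∉ C) ∧
        List.IsChain G.Adj (a :: (l ++ [c]))) := by
    have h' := h.2
    clear h ha
    induction h' using Relation.ReflTransGen.head_induction_on with
    | refl => exact ⟨t, ht, ⟨.nil, by simpa using htS⟩, .inl rfl⟩
    | @head a d had _ ih =>
      obtain ⟨c, hc, ⟨w, hw⟩, hdc⟩ := ih
      have hl : ∃ l : List V, (∀ x ∈ l, x ∉ C) ∧ List.IsChain G.Adj (a :: (l ++ [c])) := by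
        rcases hdc with rfl | ⟨hd, l, hl, hchain⟩
        · exact ⟨[], by simp, by simpa using had.1⟩
        · refine ⟨d :: l, fun x hx => ?_, ?_⟩
          · rcases List.mem_cons.1 hx with rfl | hx
            exacts [hd, hl x hx]
          · rw [List.cons_append, List.isChain_cons_cons]
            exact ⟨had.1, hchain⟩
      by_cases haC : a ∈ C
      · refine ⟨a, haC, ?_, .inl rfl⟩
        rcases eq_or_ne a c with rfl | hne
        · exact ⟨w, hw⟩
        · have hadj : (SimpleGraph.fromRel (G.torso C).Adj).Adj a c :=
            (SimpleGraph.fromRel_adj _ _ _).2 ⟨hne, .inl ⟨haC, hc, hl⟩⟩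
          refine ⟨.cons hadj w, fun x hx => ?_⟩
          rw [SimpleGraph.Walk.support_cons, List.mem_cons] at hx
          rcases hx with rfl | hx
          exacts [had.2.1, hw x hx]
      · exact ⟨c, hc, ⟨w, hw⟩, .inr ⟨haC, hl⟩⟩
  obtain ⟨c, -, hw, rfl | ⟨haC, -⟩⟩ := key
  · exact hw
  · exact absurd ha haC

end FinDigraph

/-! ### The undirected instance and the success probability of the algorithm -/

namespace DirectedInstance

variable {V : Type u} [DecidableEq V] {I : DirectedInstance V} {S Z : Finset V}

theorem WellFormed.underlying_reduce (hI : I.WellFormed) (hZ : Disjoint Z I.terminals) :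
    (I.reduce Z).underlying.WellFormed := by
  refine ⟨fun a b h => ?_, Finset.subset_sdiff.2 ⟨hI.1, hZ.symm⟩,
    Finset.sdiff_subset_sdiff hI.2 le_rfl⟩
  obtain ⟨-, h | h⟩ := (SimpleGraph.fromRel_adj _ _ _).1 h
  exacts [h.1, h.2.1]

theorem isSolution_of_underlying_reduce (hI : I.WellFormed) (hZ : Disjoint Z I.terminals)
    (hS : (I.reduce Z).underlying.IsSolution S) : I.IsSolution S := by
  have hTV : ∀ t ∈ I.terminals, t ∈ I.graph.verts \ Z := fun t ht =>
    Finset.mem_sdiff.2 ⟨hI.2 (hI.1 ht), fun h => Finset.disjoint_left.1 hZ h ht⟩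
  refine ⟨fun x hx => ?_, hS.2.1, fun s hs t ht hst h => ?_⟩
  · have : x ∈ (I.graph.verts \ Z) \ (I.distinguished \ Z) := hS.1 hx
    simp only [Finset.mem_sdiff] at this ⊢
    tauto
  · exact hS.2.2 s hs t ht hst (FinDigraph.exists_torso_walk h (hTV s hs) (hTV t ht))

theorem IsSolution.eq_of_reach (hS : I.IsSolution S) {s t : V} (hs : s ∈ I.terminals)
    (ht : t ∈ I.terminals) (h : (I.graph.delete S).Reach s t) : s = t := by
  by_contra hne
  exact hS.2.2 s hs t ht hne h

/-- If `Z` contains no vertex of the solution `S` and all vertices that are not live, then `S` is a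
solution of the undirected instance. -/
theorem IsSolution.underlying_reduce (hS : I.IsSolution S) (hI : I.WellFormed)
    (hSZ : Disjoint S Z)
    (hlive : ∀ v ∈ I.graph.verts \ Z, v ∉ S → I.graph.IsLive I.terminals S v) :
    (I.reduce Z).underlying.IsSolution S := by
  have hSC : S ⊆ I.graph.verts \ Z :=
    Finset.subset_sdiff.2 ⟨hS.1.trans Finset.sdiff_subset, hSZ⟩
  -- Invariant along the walk: each vertex is reachable from s and reaches s. The next vertex is
  -- live, its incoming and outgoing terminals agree because S is a solution, and a torso edge in
  -- either direction forces this terminal to be s.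
  have key : ∀ {a b : V} (w : (I.reduce Z).underlying.graph.Walk a b) {s : V},
      s ∈ I.terminals → (∀ x ∈ w.support, x ∉ S) → (I.graph.delete S).Reach s a →
      (I.graph.delete S).Reach a s → (I.graph.delete S).Reach s b := by
    intro a b w
    induction w with
    | nil => exact fun _ _ h _ => h
    | @cons a c b hac w ih =>
      intro s hs hw hsa has
      rw [SimpleGraph.Walk.support_cons] at hw
      have haS : a ∉ S := hw a (by simp)
      have hcS : c ∉ S := hw c (by simp)
      have hac' : (I.graph.torso (I.graph.verts \ Z)).Adj a c ∨
          (I.graph.torso (I.graph.verts \ Z)).Adj c a :=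
        ((SimpleGraph.fromRel_adj _ _ _).1 hac).2
      have hc : c ∈ I.graph.verts \ Z := by
        rcases hac' with h | h
        exacts [h.2.1, h.1]
      obtain ⟨⟨t, ht, hct⟩, r, hr, hrc⟩ := hlive c hc hcS
      rw [FinDigraph.reach_delete_reverse] at hrc
      have hrt : r = t := hS.eq_of_reach hr ht (hrc.trans hct)
      subst hrt
      have hsr : s = r := by
        rcases hac' with h | h
        · exact hS.eq_of_reach hs ht
            ((hsa.trans (FinDigraph.reach_delete_of_torso_adj hSC h haS hcS)).trans hct)
        · exact (hS.eq_of_reach ht hs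
            ((hrc.trans (FinDigraph.reach_delete_of_torso_adj hSC h hcS haS)).trans has)).symm
      subst hsr
      exact ih hs (fun x hx => hw x (by simp [hx])) hrc hct
  refine ⟨fun x hx => ?_, hS.2.1, ?_⟩
  · have h₁ := Finset.mem_sdiff.1 (hS.1 hx)
    have h₂ : x ∈ (I.graph.verts \ Z) \ (I.distinguished \ Z) := by
      simp only [Finset.mem_sdiff]
      exact ⟨Finset.mem_sdiff.1 (hSC hx), fun h => h₁.2 h.1⟩
    exact h₂
  · rintro s hs t ht hst ⟨w, hw⟩
    have hss : (I.graph.delete S).Reach s s := .refl (Finset.mem_sdiff.2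
      ⟨hI.2 (hI.1 hs), hS.notMem_of_mem_terminals hI hs⟩)
    exact hst (hS.eq_of_reach hs ht (key w hs hw hss hss))

/-- The last step returns a solution as soon as the undirected instance has one. -/
theorem exists_isSolution_of_isExactSolver {solve : UndirectedInstance V → Option (Finset V)}
    (hsolve : UndirectedInstance.IsExactSolver solve) (hI : I.WellFormed)
    (hZ : Disjoint Z I.terminals) (h : ∃ S, (I.reduce Z).underlying.IsSolution S) :
    ∃ S, solve (I.reduce Z).underlying = some S ∧ I.IsSolution S := by
  obtain ⟨h₁, h₂⟩ := hsolve _ (hI.underlying_reduce hZ)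
  obtain ⟨S, hS⟩ := h
  rcases ho : solve (I.reduce Z).underlying with - | S'
  · exact absurd hS (h₂ ho S)
  · exact ⟨S', rfl, isSolution_of_underlying_reduce hI hZ (h₁ S' ho)⟩

/-- Without terminals, every run of the algorithm returns a solution. -/
theorem toOuterMeasure_multiwayCutAlgorithm_of_terminals_eq_empty
    {solve : UndirectedInstance V → Option (Finset V)}
    (hsolve : UndirectedInstance.IsExactSolver solve) (hI : I.WellFormed)
    (hT : I.terminals = ∅) :
    (I.multiwayCutAlgorithm solve).toOuterMeasure
      {o | ∃ S : Finset V, o = some S ∧ I.IsSolution S} = 1 := by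
  rw [PMF.toOuterMeasure_apply_eq_one_iff]
  intro o ho
  simp only [multiwayCutAlgorithm, PMF.mem_support_bind_iff, PMF.mem_support_map_iff] at ho
  obtain ⟨Z₁, -, Z₂, -, rfl⟩ := ho
  refine exists_isSolution_of_isExactSolver hsolve hI (by simp [hT])
    ⟨∅, Finset.empty_subset _, by simp, fun s hs => ?_⟩
  have hs : s ∈ I.terminals := hs
  simp [hT] at hs

theorem IsExtremalSolution.le_toOuterMeasure_multiwayCutAlgorithm
    {solve : UndirectedInstance V → Option (Finset V)}
    (hsolve : UndirectedInstance.IsExactSolver solve) (hI : I.WellFormed)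
    (hT : I.terminals.Nonempty) (hS : I.IsExtremalSolution S) :
    ((2 : ℝ≥0∞) ^ 2 ^ (3 * I.budget + 1))⁻¹ ≤
      (I.multiwayCutAlgorithm solve).toOuterMeasure
        {o | ∃ S : Finset V, o = some S ∧ I.IsSolution S} := by
  have hfirst := (hS.isSampleable hI hT).le_toOuterMeasure_randomSet hI
  have hsecond : ∀ Z₁ ∈ {Z | I.IsGoodSample S Z}, ((2 : ℝ≥0∞) ^ 2 ^ (3 * I.budget))⁻¹ ≤
      ((I.reverseWith Z₁).randomSet.map fun Z₂ =>
        solve (I.reduce (Z₁ ∪ Z₂)).underlying).toOuterMeasure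
          {o | ∃ S : Finset V, o = some S ∧ I.IsSolution S} := by
    rintro Z₁ ⟨hZ₁, hSZ₁, hcov₁⟩
    have hZ₁V := hZ₁.trans Finset.sdiff_subset
    have h := (hS.isSampleable_reverseWith hI hT hZ₁V hSZ₁ hcov₁).le_toOuterMeasure_randomSet
      (hI.reverseWith hZ₁V)
    refine h.trans ?_
    rw [PMF.toOuterMeasure_map_apply]
    refine MeasureTheory.measure_mono ?_
    rintro Z₂ ⟨hZ₂, hSZ₂, hcov₂⟩
    have hZT : Disjoint (Z₁ ∪ Z₂) I.terminals := Finset.disjoint_union_left.2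
      ⟨(Finset.subset_sdiff.1 hZ₁).2, (Finset.subset_sdiff.1 hZ₂).2⟩
    refine exists_isSolution_of_isExactSolver hsolve hI hZT ⟨S, hS.isSolution.underlying_reduce hI
      (Finset.disjoint_union_right.2 ⟨hSZ₁, hSZ₂⟩) fun v hv hvS => ?_⟩
    obtain ⟨hvV, hvZ⟩ := Finset.mem_sdiff.1 hv
    rw [Finset.mem_union, not_or] at hvZ
    -- Surviving Z₁ means reaching a terminal, and surviving Z₂ means being reached from one.
    exact ⟨not_imp_comm.1 (hcov₁ v hvV hvS) hvZ.1, not_imp_comm.1 (hcov₂ v hvV hvS) hvZ.2⟩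
  refine le_trans ?_ (PMF.mul_le_toOuterMeasure_bind I.randomSet _ hsecond)
  refine le_trans (le_of_eq ?_) (mul_le_mul_left hfirst _)
  -- Two factors 2^(-2^(3p)) multiply to 2^(-2^(3p+1)), which is the source of the summand 1 in f.
  rw [← ENNReal.mul_inv (by simp) (by simp), ← pow_add, pow_succ, mul_two]

end DirectedInstance

end

theorem mainTheorem5 :
    ∃ f : ℕ → ℕ,
      ((fun p : ℕ => (f p : ℝ)) =O[Filter.atTop] fun p : ℕ => (p : ℝ)) ∧
      ∀ (V : Type u) [DecidableEq V] (solve : UndirectedInstance V → Option (Finset V)),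
        UndirectedInstance.IsExactSolver solve →
        ∀ I : DirectedInstance V, I.WellFormed → I.IsYes →
          ((2 : ℝ≥0∞) ^ (2 ^ f I.budget))⁻¹ ≤
            (I.multiwayCutAlgorithm solve).toOuterMeasure
              {o | ∃ S : Finset V, o = some S ∧ I.IsSolution S} := by
  refine ⟨fun p => 3 * p + 1, ?_, fun V _ solve hsolve I hI hyes => ?_⟩
  -- 3p + 1 ≤ 4p once p ≥ 1.
  · refine Asymptotics.IsBigO.of_bound 4 ?_
    filter_upwards [Filter.eventually_ge_atTop 1] with p hp
    have hp : (1 : ℝ) ≤ p := by exact_mod_cast hp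
    rw [Real.norm_of_nonneg (by positivity), Real.norm_of_nonneg (by positivity)]
    push_cast
    linarith
  -- Separators require a non-empty target, so the sampling argument needs a terminal.
  · rcases I.terminals.eq_empty_or_nonempty with hT | hT
    · rw [DirectedInstance.toOuterMeasure_multiwayCutAlgorithm_of_terminals_eq_empty hsolve hI hT]
      exact ENNReal.inv_le_one.2 (one_le_pow₀ one_le_two)
    · obtain ⟨S, hS⟩ := DirectedInstance.exists_isExtremalSolution hyes
      exact hS.le_toOuterMeasure_multiwayCutAlgorithm hsolve hI hT
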